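/- Let $\Omega=(l_1,l_2)^2$, $T>0$, and let $\kappa>0,\alpha,\beta,\lambda,\phi$ be smooth on $\overline\Omega\times[0,T]$; consider $u_t-\nabla\cdot(\kappa\nabla u)+\alpha u_x+\beta u_y+\lambda u=\phi$. Fix $\rho>0$, put $\tau=\rho h$ with $h=(l_2-l_1)/N$, and choose one of the methods CN, BDF3, BDF4, whose step is posed at $t=t_{n+s}=(n+s)\tau\le T$, $n\in\mathbb Z_{\ge0}$, with $s=\tfrac12,3,4$ respectively. Each step is an equation for $\mathsf u=u^{n+s}$, $$\Delta \mathsf u+\mathsf a\,\mathsf u_x+\mathsf b\,\mathsf u_y+\tfrac1{\rho h}\mathsf d_1\mathsf u+\mathsf d_2\mathsf u=\mathsf f,\qquad \mathsf f=\mathsf f_1+\tfrac1{\rho h}\mathsf f_2,\tag{1}$$ where, all data being taken at time $t$, $\mathsf a=(\kappa_x-\alpha)/\kappa$, $\mathsf b=(\kappa_y-\beta)/\kappa$, $\mathsf d_2=-\lambda/\kappa$, $\mathsf f_1=-\phi/\kappa$, and $(\mathsf d_1,\mathsf f_2)$ equals $\bigl(-\tfrac{2}{\kappa},-\tfrac{2u^n}{\kappa}\bigr)$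 for CN, $\bigl(-\tfrac{11}{6\kappa},-\tfrac{18u^{n+2}-9u^{n+1}+2u^n}{6\kappa}\bigr)$ for BDF3, $\bigl(-\tfrac{25}{12\kappa},-\tfrac{48u^{n+3}-36u^{n+2}+16u^{n+1}-3u^n}{12\kappa}\bigr)$ for BDF4. Write $v^{(m,n)}=\partial_x^m\partial_y^n v$ at a fixed base point of $\Omega$, $\Lambda_5^1=\{(m,n)\in\mathbb Z_{\ge0}^2:m\le1,\ m+n\le5\}$ and $\Lambda_3=\{(m,n)\in\mathbb Z_{\ge0}^2:m+n\le3\}$. Differentiating (1), solved for $\mathsf u_{xx}$, repeatedly and eliminating all $\mathsf u^{(p,q)}$ with $p\ge2$, $p+q\le5$, turns the fifth-degree Taylor polynomial of $\mathsf u$ at the base point into $$\sum_{(m,n)\in\Lambda_5^1}\mathsf u^{(m,n)}G_{5,m,n}(x,y)+\sum_{(m,n)\in\Lambda_3}\mathsf f^{(m,n)}H_{5,m,n}(x,y),$$ where $G_{5,m,n},H_{5,m,n}$ are polynomials in $x,y$ whose coefficients are polynomials in the derivatives of $\mathsf a$, $\mathsf b$ and $\tfrac1{\rho h}\mathsf d_1+\mathsf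 d_2$ at the base point. For real numbers $c_{r,\ell,p}$ ($r,\ell\in\{-1,0,1\}$, $0\le p\le5$) independent of $h$ put $C_{r,\ell}=\sum_{p=0}^5c_{r,\ell,p}h^p$ and $$I_{m,n}=\sum_{r,\ell=-1}^1C_{r,\ell}\,G_{5,m,n}(rh,\ell h),\qquad J_{m,n}=\sum_{r,\ell=-1}^1C_{r,\ell}\,H_{5,m,n}(rh,\ell h),$$ which are Laurent polynomials in $h$. **Theorem.** (i) For every time $t\in[0,T]$ and every base point in $\Omega$ there is exactly one family $(c_{r,\ell,p})$ such that: $I_{m,n}=\mathcal O(h^6)$ for all $(m,n)\in\Lambda_5^1$; for each $\mathsf f$, treated as independent of $h$, the lowest-degree term in $h$ of $h^{-2}\sum_{(m,n)\in\Lambda_3}\mathsf f^{(m,n)}J_{m,n}$ is the $h^0$ term and equals $\mathsf f$; the coefficients $c_{-1,0,5}$, $c_{0,-1,5}$, $c_{-1,1,p}$ and $c_{0,0,p}$ ($p=4,5$), $c_{0,1,p}$ and $c_{1,-1,p}$ ($3\le p\le5$), $c_{1,0,p}$ ($2\le p\le5$), $c_{1,1,p}$ ($1\le p\le5$) all vanish;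 and $c_{0,0,0}=-\tfrac{10}3$. (ii) With these coefficients, taken at each interior grid point $(x_i,y_j)=(l_1+ih,l_1+jh)$, $0<i,j<N$, and at the time $t=t_{n+s}$ of the step, the compact 9-point scheme $$\frac1{h^2}\sum_{r,\ell=-1}^1C_{r,\ell}\,(u_h)_{i+r,j+\ell}=F_{i,j},$$ where $F_{i,j}$ consists of the terms of degree at most $3$ in $h$ of $h^{-2}\sum_{(m,n)\in\Lambda_3}\bigl(\mathsf f_1^{(m,n)}+\tfrac1{\rho h}\mathsf f_2^{(m,n)}\bigr)J_{m,n}$ (the factor $\tfrac1{\rho h}$ counting as degree $-1$), is consistent of order four for (1): for every $M$ there is a $K$ such that for all $N\ge1$, all time levels $t_{n+s}\le T$, all previous values and all $\mathsf u$ smooth on $\overline\Omega$ which satisfy (1) in $\Omega$ and whose partial derivatives of order at most $6$ are bounded by $M$ in $\Omega$, $$\Bigl|\frac1{h^2}\sum_{r,\ell=-1}^1C_{r,\ell}\,\mathsf u(x_i+rh,y_j+\ell h)-F_{i,j}\Bigr|\le K h^4$$ at every interior grid point. -/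

import Mathlib

open scoped LaurentPolynomial ContDiff

noncomputable section

namespace CompactFDM

/-- Laurent polynomials in the mesh size `h` (the formal variable `T` stands for `h`). -/
abbrev LH : Type := LaurentPolynomial ℝ

/-- The formal mesh size `h`. -/
def hVar : LH := LaurentPolynomial.T 1

/-- The real constant `s`, as a Laurent polynomial in `h`. -/
def const (s : ℝ) : LH := LaurentPolynomial.C s

/-- The mixed partial derivative `∂^{m+n} v / ∂x^m ∂y^n` at `(x, y)`. -/
def pd (m n : ℕ) (v : ℝ → ℝ → ℝ) (x y : ℝ) : ℝ :=
  iteratedDeriv m (fun s => iteratedDeriv n (fun z => v s z) y) x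

/-- The family of all partial derivatives of `v` at `(x, y)`. -/
def jet (v : ℝ → ℝ → ℝ) (x y : ℝ) (m n : ℕ) : ℝ := pd m n v x y

/-! ### Eliminating the derivatives of order at least two in `x` -/

/-- Differentiating `u_xx = f - u_yy - a u_x - b u_y - d u` repeatedly expresses every derivative
`u^{(p,q)}` through the derivatives `u^{(0,q')} = g₀ q'`, `u^{(1,q')} = g₁ q'` and
`f^{(m,n)} = s m n`; `elim a b d g₀ g₁ s p q` is the resulting value of `u^{(p,q)}`, where
`a i j`, `b i j`, `d i j` are the derivatives of the coefficients at the base point. -/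
def elim (a b d : ℕ → ℕ → LH) (g₀ g₁ : ℕ → LH) (s : ℕ → ℕ → LH) : ℕ → ℕ → LH
  | 0, q => g₀ q
  | 1, q => g₁ q
  | p + 2, q =>
      s p q - elim a b d g₀ g₁ s p (q + 2)
        - ∑ i : Fin (p + 1), ∑ j : Fin (q + 1),
            const ((p.choose i : ℝ) * (q.choose j : ℝ)) *
              (a i j * elim a b d g₀ g₁ s (p + 1 - i) (q - j)
                + b i j * elim a b d g₀ g₁ s (p - i) (q + 1 - j)
                + d i j * elim a b d g₀ g₁ s (p - i) (q - j))
termination_by p => p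
decreasing_by all_goals omega

/-- The coefficient of `u^{(m,n)}` (with `m ≤ 1`) in the expression of `u^{(p,q)}`. -/
def uCoeff (a b d : ℕ → ℕ → LH) (m n p q : ℕ) : LH :=
  elim a b d (fun k => if m = 0 ∧ k = n then 1 else 0) (fun k => if m = 1 ∧ k = n then 1 else 0)
    (fun _ _ => 0) p q

/-- The coefficient of `f^{(m,n)}` in the expression of `u^{(p,q)}`. -/
def fCoeff (a b d : ℕ → ℕ → LH) (m n p q : ℕ) : LH :=
  elim a b d (fun _ => 0) (fun _ => 0) (fun k l => if k = m ∧ l = n then 1 else 0) p q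

/-- The Taylor polynomial `∑_{p+q ≤ 5} w p q x^p y^q / (p! q!)` of degree five. -/
def taylorFive (w : ℕ → ℕ → LH) (x y : LH) : LH :=
  ∑ p ∈ Finset.range 6, ∑ q ∈ Finset.range (6 - p),
    const (1 / ((p.factorial : ℝ) * (q.factorial : ℝ))) * x ^ p * y ^ q * w p q

/-- The function `G_{5,m,n}(x, y)`. -/
def G5 (a b d : ℕ → ℕ → LH) (m n : ℕ) (x y : LH) : LH := taylorFive (uCoeff a b d m n) x y

/-- The function `H_{5,m,n}(x, y)`. -/
def H5 (a b d : ℕ → ℕ → LH) (m n : ℕ) (x y : LH) : LH := taylorFive (fCoeff a b d m n) x y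

/-- `Λ₅¹ = {(m,n) : m ∈ {0,1}, m + n ≤ 5}`. -/
def Lam51 : Finset (ℕ × ℕ) :=
  (Finset.range 2 ×ˢ Finset.range 6).filter fun mn => mn.1 + mn.2 ≤ 5

/-- `Λ₃ = {(m,n) : m + n ≤ 3}`. -/
def Lam3 : Finset (ℕ × ℕ) :=
  (Finset.range 4 ×ˢ Finset.range 4).filter fun mn => mn.1 + mn.2 ≤ 3

/-! ### The nine-point scheme -/

/-- Coefficients `c r ℓ p` of a nine-point stencil, `r, ℓ ∈ {-1,0,1}`, `0 ≤ p ≤ 5`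
(the other entries are required to vanish below). -/
abbrev Stencil : Type := ℤ → ℤ → ℕ → ℝ

/-- The stencil indices `{-1, 0, 1}`. -/
def offs : Finset ℤ := Finset.Icc (-1) 1

/-- The derivatives of `d₁ / (ρ h) + d₂` at the base point. -/
def reaction (d₁ d₂ : ℕ → ℕ → ℝ) (ρ : ℝ) (i j : ℕ) : LH :=
  const (d₁ i j / ρ) * LaurentPolynomial.T (-1) + const (d₂ i j)

/-- `C_{r,ℓ} = ∑_{p=0}^5 c_{r,ℓ,p} h^p` as a polynomial in the formal variable `h`. -/
def stencilPoly (c : Stencil) (r l : ℤ) : LH := ∑ p ∈ Finset.range 6, const (c r l p) * hVar ^ p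

/-- `I_{5,m,n} = ∑_{r,ℓ} C_{r,ℓ} G_{5,m,n}(r h, ℓ h)`. -/
def momentI (a b d₁ d₂ : ℕ → ℕ → ℝ) (ρ : ℝ) (c : Stencil) (m n : ℕ) : LH :=
  ∑ r ∈ offs, ∑ l ∈ offs, stencilPoly c r l *
    G5 (fun i j => const (a i j)) (fun i j => const (b i j)) (reaction d₁ d₂ ρ) m n
      (const (r : ℝ) * hVar) (const (l : ℝ) * hVar)

/-- `J_{3,m,n} = ∑_{r,ℓ} C_{r,ℓ} H_{5,m,n}(r h, ℓ h)`. -/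
def momentJ (a b d₁ d₂ : ℕ → ℕ → ℝ) (ρ : ℝ) (c : Stencil) (m n : ℕ) : LH :=
  ∑ r ∈ offs, ∑ l ∈ offs, stencilPoly c r l *
    H5 (fun i j => const (a i j)) (fun i j => const (b i j)) (reaction d₁ d₂ ρ) m n
      (const (r : ℝ) * hVar) (const (l : ℝ) * hVar)

/-- `h^{-2} ∑_{(m,n) ∈ Λ₃} f^{(m,n)} J_{3,m,n}`, where `s m n` stands for `f^{(m,n)}`. -/
def rhsSeries (a b d₁ d₂ : ℕ → ℕ → ℝ) (ρ : ℝ) (c : Stencil) (s : ℕ → ℕ → LH) : LH :=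
  LaurentPolynomial.T (-2) * ∑ mn ∈ Lam3, s mn.1 mn.2 * momentJ a b d₁ d₂ ρ c mn.1 mn.2

/-- The defining conditions of the stencil coefficients at one point; `a`, `b`, `d₁`, `d₂` are the
derivatives of the coefficients of the equation at that point, and `ρ = τ / h`. -/
structure IsScheme (a b d₁ d₂ : ℕ → ℕ → ℝ) (ρ : ℝ) (c : Stencil) : Prop where
  /-- only `r, ℓ ∈ {-1,0,1}` and `p ≤ 5` occur -/
  support : ∀ r l p, ¬ (r ∈ offs ∧ l ∈ offs ∧ p ≤ 5) → c r l p = 0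
  /-- `I_{5,m,n} = O(h^6)` for all `(m,n) ∈ Λ₅¹`: all terms of degree below six vanish -/
  moment : ∀ mn ∈ Lam51, ∀ k : ℤ, k < 6 → (momentI a b d₁ d₂ ρ c mn.1 mn.2).coeff k = 0
  /-- the lowest degree term in `h` of the right-hand side is the `h^0` term, and equals `f` -/
  leading : ∀ f : ℕ → ℕ → ℝ,
    (∀ k : ℤ, k < 0 → (rhsSeries a b d₁ d₂ ρ c (fun m n => const (f m n))).coeff k = 0) ∧
      (rhsSeries a b d₁ d₂ ρ c (fun m n => const (f m n))).coeff 0 = f 0 0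
  vanish_m1_0 : c (-1) 0 5 = 0
  vanish_m1_1 : ∀ p, 4 ≤ p → p ≤ 5 → c (-1) 1 p = 0
  vanish_0_m1 : c 0 (-1) 5 = 0
  vanish_0_0 : ∀ p, 4 ≤ p → p ≤ 5 → c 0 0 p = 0
  vanish_0_1 : ∀ p, 3 ≤ p → p ≤ 5 → c 0 1 p = 0
  vanish_1_m1 : ∀ p, 3 ≤ p → p ≤ 5 → c 1 (-1) p = 0
  vanish_1_0 : ∀ p, 2 ≤ p → p ≤ 5 → c 1 0 p = 0
  vanish_1_1 : ∀ p, 1 ≤ p → p ≤ 5 → c 1 1 p = 0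
  center : c 0 0 0 = -10 / 3

/-- The value at `h` of the sum of the terms of degree at most three of a Laurent polynomial. -/
def evalUpToThree (P : LH) (h : ℝ) : ℝ :=
  ∑ k ∈ P.coeff.support.filter (fun k => k ≤ 3), P.coeff k * h ^ k

/-- The right-hand side `F_{i,j}`: the terms of degree at most three in `h` of
`h^{-2} ∑ f^{(m,n)} J_{3,m,n}` with `f = f₁ + f₂ / (ρ h)`. -/
def rhsF (a b d₁ d₂ : ℕ → ℕ → ℝ) (ρ : ℝ) (c : Stencil) (f₁ f₂ : ℕ → ℕ → ℝ) (h : ℝ) : ℝ :=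
  evalUpToThree
    (rhsSeries a b d₁ d₂ ρ c
      (fun m n => const (f₁ m n) + const (f₂ m n / ρ) * LaurentPolynomial.T (-1))) h

/-- The discrete operator `ℒ_h v = h^{-2} ∑_{r,ℓ} ∑_p c_{r,ℓ,p} h^p v(x + r h, y + ℓ h)`. -/
def discreteOp (c : Stencil) (h : ℝ) (v : ℝ → ℝ → ℝ) (x y : ℝ) : ℝ :=
  (1 / h ^ 2) * ∑ r ∈ offs, ∑ l ∈ offs,
    (∑ p ∈ Finset.range 6, c r l p * h ^ p) * v (x + r * h) (y + l * h)

/-! ### The semi-discrete equations -/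

/-- The data of `u_t - ∇·(κ ∇u) + α u_x + β u_y + λ u = φ`, as functions of `x`, `y`, `t`. -/
structure ParabolicData where
  kappa : ℝ → ℝ → ℝ → ℝ
  alpha : ℝ → ℝ → ℝ → ℝ
  beta : ℝ → ℝ → ℝ → ℝ
  lam : ℝ → ℝ → ℝ → ℝ
  phi : ℝ → ℝ → ℝ → ℝ

/-- `v` is smooth on `[l₁,l₂]² × [0,T]`. -/
def SmoothXYT (l₁ l₂ T : ℝ) (v : ℝ → ℝ → ℝ → ℝ) : Prop :=
  ContDiffOn ℝ ∞ (fun p : ℝ × ℝ × ℝ => v p.1 p.2.1 p.2.2)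
    (Set.Icc l₁ l₂ ×ˢ (Set.Icc l₁ l₂ ×ˢ Set.Icc 0 T))

/-- `v` is smooth on `[l₁,l₂]²`. -/
def SmoothXY (l₁ l₂ : ℝ) (v : ℝ → ℝ → ℝ) : Prop :=
  ContDiffOn ℝ ∞ (fun p : ℝ × ℝ => v p.1 p.2) (Set.Icc l₁ l₂ ×ˢ Set.Icc l₁ l₂)

/-- All data are smooth on `[l₁,l₂]² × [0,T]`, and `κ > 0` there. -/
structure ParabolicData.Admissible (P : ParabolicData) (l₁ l₂ T : ℝ) : Prop where
  smooth_kappa : SmoothXYT l₁ l₂ T P.kappa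
  smooth_alpha : SmoothXYT l₁ l₂ T P.alpha
  smooth_beta : SmoothXYT l₁ l₂ T P.beta
  smooth_lam : SmoothXYT l₁ l₂ T P.lam
  smooth_phi : SmoothXYT l₁ l₂ T P.phi
  kappa_pos : ∀ x ∈ Set.Icc l₁ l₂, ∀ y ∈ Set.Icc l₁ l₂, ∀ t ∈ Set.Icc 0 T, 0 < P.kappa x y t

/-- The three time-stepping methods. -/
inductive Method where
  | CN
  | BDF3
  | BDF4

/-- The equation of the time step is posed at the time `t_{n+i}` with `i = 1/2, 3, 4`. -/
def Method.shift : Method → ℝ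
  | .CN => 1 / 2
  | .BDF3 => 3
  | .BDF4 => 4

/-- The weight of the new value in the difference quotient. -/
def Method.lead : Method → ℝ
  | .CN => 2
  | .BDF3 => 11 / 6
  | .BDF4 => 25 / 12

/-- The combination of the previous values `u^n, u^{n+1}, …` (here `w 0, w 1, …`) in the difference
quotient, which is `(lead * new value - history) / τ`. -/
def Method.history : Method → (ℕ → ℝ → ℝ → ℝ) → ℝ → ℝ → ℝ
  | .CN, w, x, y => 2 * w 0 x y
  | .BDF3, w, x, y => (18 * w 2 x y - 9 * w 1 x y + 2 * w 0 x y) / 6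
  | .BDF4, w, x, y => (48 * w 3 x y - 36 * w 2 x y + 16 * w 1 x y - 3 * w 0 x y) / 12

/-- `a = (κ_x - α) / κ` at time `t`. -/
def ParabolicData.a (P : ParabolicData) (t x y : ℝ) : ℝ :=
  (pd 1 0 (fun x y => P.kappa x y t) x y - P.alpha x y t) / P.kappa x y t

/-- `b = (κ_y - β) / κ` at time `t`. -/
def ParabolicData.b (P : ParabolicData) (t x y : ℝ) : ℝ :=
  (pd 0 1 (fun x y => P.kappa x y t) x y - P.beta x y t) / P.kappa x y t

/-- `d₁`, that is `-2/κ`, `-11/(6κ)` or `-25/(12κ)`, at time `t`. -/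
def ParabolicData.d₁ (P : ParabolicData) (μ : Method) (t x y : ℝ) : ℝ :=
  -μ.lead / P.kappa x y t

/-- `d₂ = -λ/κ` at time `t`. -/
def ParabolicData.d₂ (P : ParabolicData) (t x y : ℝ) : ℝ := -P.lam x y t / P.kappa x y t

/-- `f₁ = -φ/κ` at time `t`. -/
def ParabolicData.f₁ (P : ParabolicData) (t x y : ℝ) : ℝ := -P.phi x y t / P.kappa x y t

/-- `f₂` at time `t`, depending on the previous values `w`. -/
def ParabolicData.f₂ (P : ParabolicData) (μ : Method) (w : ℕ → ℝ → ℝ → ℝ) (t x y : ℝ) : ℝ :=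
  -μ.history w x y / P.kappa x y t

/-- The semi-discrete equation `Δu + a u_x + b u_y + d₁ u / τ + d₂ u = f₁ + f₂ / τ` of one time
step, at the point `(x, y)` and the time level `t`. -/
def ParabolicData.StepEq (P : ParabolicData) (μ : Method) (τ : ℝ) (w : ℕ → ℝ → ℝ → ℝ)
    (u : ℝ → ℝ → ℝ) (t x y : ℝ) : Prop :=
  pd 2 0 u x y + pd 0 2 u x y + P.a t x y * pd 1 0 u x y + P.b t x y * pd 0 1 u x y
      + 1 / τ * P.d₁ μ t x y * u x y + P.d₂ t x y * u x y
    = P.f₁ t x y + 1 / τ * P.f₂ μ w t x y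

/-- `c` satisfies the defining conditions at the point `(x, y)` and the time level `t`. -/
def ParabolicData.SchemeAt (P : ParabolicData) (μ : Method) (ρ t x y : ℝ) (c : Stencil) : Prop :=
  IsScheme (jet (P.a t) x y) (jet (P.b t) x y) (jet (P.d₁ μ t) x y) (jet (P.d₂ t) x y) ρ c

/-- The right-hand side `F` of the scheme with coefficients `c` at `(x, y)`, time level `t`. -/
def ParabolicData.schemeRhs (P : ParabolicData) (μ : Method) (ρ : ℝ) (w : ℕ → ℝ → ℝ → ℝ)
    (t x y : ℝ) (c : Stencil) (h : ℝ) : ℝ :=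
  rhsF (jet (P.a t) x y) (jet (P.b t) x y) (jet (P.d₁ μ t) x y) (jet (P.d₂ t) x y) ρ c
    (jet (P.f₁ t) x y) (jet (P.f₂ μ w t) x y) h

end CompactFDM

end

/-! Weight every derivative of order `k` with `h ^ k`. The elimination recursion keeps its shape,
its coefficients becoming `h^(i+j+1) a`, `h^(i+j+1) b` and `h^(i+j+2) (d₁/(ρh) + d₂)`. The last
weight absorbs the pole `1/h`, so everything becomes polynomial in `h`, and every scaled coefficient
vanishes at `h = 0`: to leading order the equation is `Δu = f`. Hence `I_{m,n}` is `h^(m+n)` times a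
polynomial, and `I_{m,n} = O(h^6)` says that its coefficients of degree `k` with `k + m + n ≤ 5`
vanish.

These conditions are triangular. In degree `k` the unknowns `c_{r,ℓ,k}` enter only through their
moments against harmonic polynomials on the nine nodes (`coeff_nodeMoment_uPoly`); the rest involves
lower levels. At level 0 the solutions form a line spanned by the nine-point Laplacian, and
`c_{0,0,0} = -10/3` fixes the multiple. At levels 1 to 5 the prescribed zeros leave 8, 7, 5, 3, 1
unknowns, matched by as many independent conditions. The one further condition, level 1 with `(m,n)
= (1,3)`, has a left side that is identically zero, because that harmonic polynomial vanishes on all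
nodes; it is compatible because the nine-point Laplacian kills monomials of degree five. This gives
existence and uniqueness (`isScheme_iff`), and the requirement on the leading term of the right-hand
side then holds by itself.

For consistency, the scaled derivatives of a solution are a superposition of the elementary jets
`uPoly` and `fPoly` (`scaled_jet_eq`). After division by `h^2` the first group contributes `O(h^4)`
by the moment conditions, and the second differs from `F` by the tail of degree at least four.
Replacing exact values by Taylor polynomials costs `O(h^6) / h^2`. Constants are uniform because the
derivatives of the data are bounded by compactness, while the source `f₂`, built from arbitrary
previous values, is bounded by solving the equation for it (`bddFam_f₂`). -/

noncomputable section

namespace CompactFDM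

/-! ### The elimination recursion over a commutative ring -/

section Elimination

variable {R : Type*} [CommRing R]

/-- The value which the equation assigns to `u^{(p+2,q)}`, for derivatives `w` of `u`. -/
def elimStep (a b d s w : ℕ → ℕ → R) (p q : ℕ) : R :=
  s p q - w p (q + 2) - ∑ i : Fin (p + 1), ∑ j : Fin (q + 1),
    ((p.choose i * q.choose j : ℕ) : R) *
      (a i j * w (p + 1 - i) (q - j) + b i j * w (p - i) (q + 1 - j) + d i j * w (p - i) (q - j))

/-- `w` satisfies the differentiated equations up to total order `N`. -/
def IsJet (N : ℕ) (a b d s w : ℕ → ℕ → R) : Prop :=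
  ∀ p q, p + 2 + q ≤ N → w (p + 2) q = elimStep a b d s w p q

/-- The elimination recursion over a commutative ring. -/
def elimRing (a b d : ℕ → ℕ → R) (g₀ g₁ : ℕ → R) (s : ℕ → ℕ → R) : ℕ → ℕ → R
  | 0, q => g₀ q
  | 1, q => g₁ q
  | p + 2, q =>
      s p q - elimRing a b d g₀ g₁ s p (q + 2)
        - ∑ i : Fin (p + 1), ∑ j : Fin (q + 1),
            ((p.choose i * q.choose j : ℕ) : R) *
              (a i j * elimRing a b d g₀ g₁ s (p + 1 - i) (q - j)
                + b i j * elimRing a b d g₀ g₁ s (p - i) (q + 1 - j)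
                + d i j * elimRing a b d g₀ g₁ s (p - i) (q - j))
termination_by p => p
decreasing_by all_goals omega

variable {a b d s w w' : ℕ → ℕ → R} {g₀ g₁ : ℕ → R} {N : ℕ}

@[simp] lemma elimRing_zero (q : ℕ) : elimRing a b d g₀ g₁ s 0 q = g₀ q := by rw [elimRing]

@[simp] lemma elimRing_one (q : ℕ) : elimRing a b d g₀ g₁ s 1 q = g₁ q := by rw [elimRing]

lemma elimRing_add_two (p q : ℕ) : elimRing a b d g₀ g₁ s (p + 2) q =
    elimStep a b d s (elimRing a b d g₀ g₁ s) p q := by rw [elimRing]; rfl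

lemma isJet_elimRing : IsJet N a b d s (elimRing a b d g₀ g₁ s) :=
  fun p q _ => elimRing_add_two p q

/-- With the values at `p = 0` and `p = 1`, this is all that is needed about `elim`: `IsJet.unique`
transfers the rest from the ring-generic recursion. -/
lemma isJet_elim {a b d s : ℕ → ℕ → LH} {g₀ g₁ : ℕ → LH} :
    IsJet N a b d s (elim a b d g₀ g₁ s) := by
  intro p q _
  rw [elim, elimStep]
  simp [const]

@[simp] lemma elim_zero {a b d s : ℕ → ℕ → LH} {g₀ g₁ : ℕ → LH} (q : ℕ) :
    elim a b d g₀ g₁ s 0 q = g₀ q := by rw [elim]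

@[simp] lemma elim_one {a b d s : ℕ → ℕ → LH} {g₀ g₁ : ℕ → LH} (q : ℕ) :
    elim a b d g₀ g₁ s 1 q = g₁ q := by rw [elim]

/-- The step reads only entries of smaller first index and of total order at most `p + 2 + q`, which
is what permits induction on `p` below a fixed order. -/
lemma elimStep_congr {s' : ℕ → ℕ → R} (p q : ℕ) (hs : s p q = s' p q)
    (h : ∀ p' q', p' ≤ p + 1 → p' + q' ≤ p + 2 + q → w p' q' = w' p' q') :
    elimStep a b d s w p q = elimStep a b d s' w' p q := by
  unfold elimStep
  rw [hs, h p (q + 2) (by omega) (by omega)]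
  congr 1
  refine Finset.sum_congr rfl fun i _ => Finset.sum_congr rfl fun j _ => ?_
  have hi := i.2
  have hj := j.2
  rw [h (p + 1 - i) (q - j) (by omega) (by omega), h (p - i) (q + 1 - j) (by omega) (by omega),
    h (p - i) (q - j) (by omega) (by omega)]

/-- A jet is determined by its entries `w 0 q` and `w 1 q`. -/
lemma IsJet.unique {s' : ℕ → ℕ → R} (hw : IsJet N a b d s w) (hw' : IsJet N a b d s' w')
    (hs : ∀ p q, p + 2 + q ≤ N → s p q = s' p q)
    (h0 : ∀ q, q ≤ N → w 0 q = w' 0 q) (h1 : ∀ q, 1 + q ≤ N → w 1 q = w' 1 q) :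
    ∀ p q, p + q ≤ N → w p q = w' p q := by
  intro p
  induction p using Nat.strong_induction_on with
  | _ p ih =>
    intro q hpq
    match p, ih, hpq with
    | 0, _, hpq => exact h0 q (by omega)
    | 1, _, hpq => exact h1 q hpq
    | p + 2, ih, hpq =>
      rw [hw p q hpq, hw' p q hpq]
      exact elimStep_congr p q (hs p q hpq) fun p' q' h1 h2 => ih p' (by omega) q' (by omega)

lemma IsJet.map {S : Type*} [CommRing S] (φ : R →+* S) (hw : IsJet N a b d s w) :
    IsJet N (fun i j => φ (a i j)) (fun i j => φ (b i j)) (fun i j => φ (d i j))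
      (fun i j => φ (s i j)) (fun i j => φ (w i j)) := by
  intro p q h
  simp [hw p q h, elimStep]

/-- Both sides are jets for the same mapped data with the same free entries, so uniqueness replaces
a second induction. -/
lemma map_elimRing {S : Type*} [CommRing S] (φ : R →+* S) (p q : ℕ) :
    φ (elimRing a b d g₀ g₁ s p q) = elimRing (fun i j => φ (a i j)) (fun i j => φ (b i j))
      (fun i j => φ (d i j)) (fun q => φ (g₀ q)) (fun q => φ (g₁ q)) (fun i j => φ (s i j)) p q :=
  IsJet.unique (N := p + q) (isJet_elimRing.map φ) isJet_elimRing (fun _ _ _ => rfl)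
    (by simp) (by simp) p q le_rfl

/-- Meant for the subring of uniformly bounded families of polynomials, where membership is a bound
on all eliminated coefficients at once. -/
lemma elimRing_mem (S : Subring R) (ha : ∀ i j, a i j ∈ S) (hb : ∀ i j, b i j ∈ S)
    (hd : ∀ i j, d i j ∈ S) (hs : ∀ i j, s i j ∈ S) (h0 : ∀ q, g₀ q ∈ S) (h1 : ∀ q, g₁ q ∈ S)
    (p q : ℕ) : elimRing a b d g₀ g₁ s p q ∈ S := by
  induction p using Nat.strong_induction_on generalizing q with
  | _ p ih =>
    match p, ih with
    | 0, _ => simpa using h0 q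
    | 1, _ => simpa using h1 q
    | p + 2, ih =>
      rw [elimRing_add_two, elimStep]
      refine sub_mem (sub_mem (hs _ _) (ih _ (by omega) _)) (sum_mem fun i _ => sum_mem fun j _ =>
        mul_mem (natCast_mem _ _) (add_mem (add_mem ?_ ?_) ?_))
      · exact mul_mem (ha _ _) (ih _ (by omega) _)
      · exact mul_mem (hb _ _) (ih _ (by omega) _)
      · exact mul_mem (hd _ _) (ih _ (by omega) _)

/-- Source and jet depend linearly on each other; together with sums this gives superposition of
elementary jets. -/
lemma IsJet.const_mul (e : R) (hw : IsJet N a b d s w) :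
    IsJet N a b d (fun i j => e * s i j) (fun i j => e * w i j) := by
  intro p q h
  simp only [hw p q h, elimStep, mul_sub, Finset.mul_sum]
  congr 1
  refine Finset.sum_congr rfl fun i _ => Finset.sum_congr rfl fun j _ => ?_
  ring

lemma IsJet.add {s' : ℕ → ℕ → R} (hw : IsJet N a b d s w) (hw' : IsJet N a b d s' w') :
    IsJet N a b d (fun i j => s i j + s' i j) (fun i j => w i j + w' i j) := by
  intro p q h
  simp only [hw p q h, hw' p q h, elimStep]
  have : ∀ x y z x' y' z' t : R, t = z + z' → (x - y - z) + (x' - y' - z') =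
    x + x' - (y + y') - t := by rintro x y z x' y' z' t rfl; ring
  refine this _ _ _ _ _ _ _ ?_
  simp only [← Finset.sum_add_distrib]
  refine Finset.sum_congr rfl fun i _ => Finset.sum_congr rfl fun j _ => ?_
  ring

lemma isJet_zero : IsJet N a b d (fun _ _ => 0) (fun _ _ => 0) := by
  intro p q h
  simp [elimStep]

lemma IsJet.sum {κ : Type*} {S : Finset κ} {s w : κ → ℕ → ℕ → R}
    (hw : ∀ k ∈ S, IsJet N a b d (s k) (w k)) :
    IsJet N a b d (fun i j => ∑ k ∈ S, s k i j) (fun i j => ∑ k ∈ S, w k i j) := by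
  classical
  induction S using Finset.induction_on with
  | empty => simpa using isJet_zero
  | insert k S hk ih =>
    simp only [Finset.sum_insert hk]
    exact (hw k (by simp)).add (ih fun k' hk' => hw k' (by simp [hk']))

/-- Weighting the derivatives of order `k` with `e ^ k`. -/
lemma IsJet.scale (e : R) (hw : IsJet N a b d s w) :
    IsJet N (fun i j => e ^ (i + j + 1) * a i j) (fun i j => e ^ (i + j + 1) * b i j)
      (fun i j => e ^ (i + j + 2) * d i j) (fun i j => e ^ (i + j + 2) * s i j)
      (fun i j => e ^ (i + j) * w i j) := by
  intro p q h
  simp only [hw p q h, elimStep, mul_sub, Finset.mul_sum]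
  rw [show p + 2 + q = p + q + 2 by ring, show p + (q + 2) = p + q + 2 by ring]
  congr 1
  refine Finset.sum_congr rfl fun i _ => Finset.sum_congr rfl fun j _ => ?_
  have hi := i.2
  have hj := j.2
  -- The terms with `a` and `b` fall one order short of `p + q + 2` and the term with `d` two orders
  -- short; the missing powers go to the coefficients.
  have e1 : e ^ (p + q + 2) = e ^ (i + j + 1 : ℕ) * e ^ (p + 1 - i + (q - j)) := by
    rw [← pow_add]; congr 1; omega
  have e2 : e ^ (p + q + 2) = e ^ (i + j + 1 : ℕ) * e ^ (p - i + (q + 1 - j)) := by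
    rw [← pow_add]; congr 1; omega
  have e3 : e ^ (p + q + 2) = e ^ (i + j + 2 : ℕ) * e ^ (p - i + (q - j)) := by
    rw [← pow_add]; congr 1; omega
  linear_combination ((p.choose i * q.choose j : ℕ) : R) *
    (a i j * w (p + 1 - i) (q - j) * e1 + b i j * w (p - i) (q + 1 - j) * e2 +
      d i j * w (p - i) (q - j) * e3)

end Elimination

/-! ### The scaled coefficients -/

section Scaled

open Polynomial

/-- Derivatives of a first order coefficient, scaled by powers of the mesh size. -/
def scaledFirst (a : ℕ → ℕ → ℝ) (i j : ℕ) : ℝ[X] := X ^ (i + j + 1) * C (a i j)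

/-- Derivatives of the reaction coefficient, scaled by powers of the mesh size. -/
def scaledReaction (d₁ d₂ : ℕ → ℕ → ℝ) (ρ : ℝ) (i j : ℕ) : ℝ[X] :=
  X ^ (i + j + 1) * C (d₁ i j / ρ) + X ^ (i + j + 2) * C (d₂ i j)

/-- The scaled coefficient of `u^{(m,n)}` in `u^{(p,q)}`. -/
def uPoly (a b d₁ d₂ : ℕ → ℕ → ℝ) (ρ : ℝ) (m n p q : ℕ) : ℝ[X] :=
  elimRing (scaledFirst a) (scaledFirst b) (scaledReaction d₁ d₂ ρ)
    (fun k => if m = 0 ∧ k = n then 1 else 0) (fun k => if m = 1 ∧ k = n then 1 else 0)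
    (fun _ _ => 0) p q

/-- The scaled coefficient of `f^{(m,n)}` in `u^{(p,q)}`. -/
def fPoly (a b d₁ d₂ : ℕ → ℕ → ℝ) (ρ : ℝ) (m n p q : ℕ) : ℝ[X] :=
  elimRing (scaledFirst a) (scaledFirst b) (scaledReaction d₁ d₂ ρ)
    (fun _ => 0) (fun _ => 0) (fun k l => if k = m ∧ l = n then 1 else 0) p q

variable (a b d₁ d₂ : ℕ → ℕ → ℝ) (ρ : ℝ)

lemma hVar_eq : hVar = toLaurent (X : ℝ[X]) := by simp [hVar]

lemma const_eq (r : ℝ) : const r = toLaurent (C r) := by simp [const]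

lemma toLaurent_scaledFirst (i j : ℕ) :
    toLaurent (scaledFirst a i j) = hVar ^ (i + j + 1) * const (a i j) := by
  simp only [scaledFirst, hVar_eq, const_eq, map_mul, map_pow]

/-- The weight `h^(i+j+2)` absorbs the pole `1/h`, so the scaled recursion lives in `ℝ[X]`. -/
lemma toLaurent_scaledReaction (i j : ℕ) : toLaurent (scaledReaction d₁ d₂ ρ i j) =
    hVar ^ (i + j + 2) * reaction d₁ d₂ ρ i j := by
  have : hVar ^ (i + j + 2) * LaurentPolynomial.T (-1) = hVar ^ (i + j + 1) := by
    simp only [hVar, LaurentPolynomial.T_pow, ← LaurentPolynomial.T_add]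
    congr 1; push_cast; ring
  rw [reaction, mul_add, mul_left_comm, this]
  simp only [scaledReaction, hVar_eq, const_eq, map_mul, map_pow, map_add]
  ring

lemma isJet_scale_toLaurent {s w : ℕ → ℕ → LH} {N : ℕ}
    (h : IsJet N (fun i j => const (a i j)) (fun i j => const (b i j)) (reaction d₁ d₂ ρ) s w) :
    IsJet N (fun i j => toLaurent (scaledFirst a i j)) (fun i j => toLaurent (scaledFirst b i j))
      (fun i j => toLaurent (scaledReaction d₁ d₂ ρ i j)) (fun i j => hVar ^ (i + j + 2) * s i j)
      (fun i j => hVar ^ (i + j) * w i j) := by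
  simpa only [toLaurent_scaledFirst, toLaurent_scaledReaction] using h.scale hVar

/-- The factor `X ^ (m + n)` is the weight of the free entry `u^{(m,n)}` itself. -/
lemma uCoeff_eq (m n p q : ℕ) :
    hVar ^ (p + q) * uCoeff (fun i j => const (a i j)) (fun i j => const (b i j))
      (reaction d₁ d₂ ρ) m n p q = toLaurent (X ^ (m + n) * uPoly a b d₁ d₂ ρ m n p q) := by
  rw [map_mul, map_pow, ← hVar_eq, uCoeff, uPoly]
  have h1 := isJet_scale_toLaurent a b d₁ d₂ ρ (N := p + q) (isJet_elim
    (s := fun _ _ => 0) (g₀ := fun k => if m = 0 ∧ k = n then 1 else 0)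
    (g₁ := fun k => if m = 1 ∧ k = n then 1 else 0))
  have h2 := ((isJet_elimRing (N := p + q) (a := scaledFirst a) (b := scaledFirst b)
    (d := scaledReaction d₁ d₂ ρ) (s := fun _ _ => 0)
    (g₀ := fun k => if m = 0 ∧ k = n then 1 else 0)
    (g₁ := fun k => if m = 1 ∧ k = n then 1 else 0)).map toLaurent).const_mul (hVar ^ (m + n))
  refine h1.unique h2 (by simp) (fun q _ => ?_) (fun q _ => ?_) p q le_rfl
  · simp only [elim_zero, elimRing_zero]
    split_ifs with h
    · simp [h]
    · simp
  · simp only [elim_one, elimRing_one]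
    split_ifs with h
    · simp [h]
    · simp

/-- The exponent is larger by two than for `uCoeff` because `f` has the order of a second derivative
of `u`. -/
lemma fCoeff_eq (m n p q : ℕ) :
    hVar ^ (p + q) * fCoeff (fun i j => const (a i j)) (fun i j => const (b i j))
      (reaction d₁ d₂ ρ) m n p q = toLaurent (X ^ (m + n + 2) * fPoly a b d₁ d₂ ρ m n p q) := by
  rw [map_mul, map_pow, ← hVar_eq, fCoeff, fPoly]
  have h1 := isJet_scale_toLaurent a b d₁ d₂ ρ (N := p + q) (isJet_elim
    (s := fun k l => if k = m ∧ l = n then 1 else 0) (g₀ := fun _ => 0) (g₁ := fun _ => 0))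
  have h2 := ((isJet_elimRing (N := p + q) (a := scaledFirst a) (b := scaledFirst b)
    (d := scaledReaction d₁ d₂ ρ) (s := fun k l => if k = m ∧ l = n then 1 else 0)
    (g₀ := fun _ => 0) (g₁ := fun _ => 0)).map toLaurent).const_mul (hVar ^ (m + n + 2))
  refine h1.unique h2 (fun p q _ => ?_) (fun q _ => ?_) (fun q _ => ?_) p q le_rfl
  · split_ifs with h
    · simp [h]
    · simp
  · simp only [elim_zero, elimRing_zero, map_zero, mul_zero]
  · simp only [elim_one, elimRing_one, map_zero, mul_zero]

/-- Fifth degree Taylor polynomial at the node `(r, l)`, from scaled derivatives. -/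
def nodeTaylor (w : ℕ → ℕ → ℝ[X]) (r l : ℤ) : ℝ[X] :=
  ∑ p ∈ Finset.range 6, ∑ q ∈ Finset.range (6 - p),
    C ((r : ℝ) ^ p * (l : ℝ) ^ q / ((p.factorial : ℝ) * (q.factorial : ℝ))) * w p q

/-- `C_{r,ℓ}` as an ordinary polynomial. -/
def stencilPolynomial (c : Stencil) (r l : ℤ) : ℝ[X] := ∑ p ∈ Finset.range 6, C (c r l p) * X ^ p

/-- The stencil applied to scaled derivatives. -/
def nodeMoment (c : Stencil) (w : ℕ → ℕ → ℝ[X]) : ℝ[X] :=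
  ∑ r ∈ offs, ∑ l ∈ offs, stencilPolynomial c r l * nodeTaylor w r l

lemma stencilPoly_eq (c : Stencil) (r l : ℤ) :
    stencilPoly c r l = toLaurent (stencilPolynomial c r l) := by
  simp only [stencilPoly, stencilPolynomial, hVar_eq, const_eq, map_sum, map_mul, map_pow]

lemma taylorFive_eq {v : ℕ → ℕ → LH} {w : ℕ → ℕ → ℝ[X]} {e : ℕ}
    (h : ∀ p q, hVar ^ (p + q) * v p q = toLaurent (X ^ e * w p q)) (r l : ℤ) :
    taylorFive v (const (r : ℝ) * hVar) (const (l : ℝ) * hVar) =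
      toLaurent (X ^ e * nodeTaylor w r l) := by
  simp only [taylorFive, nodeTaylor, Finset.mul_sum, map_sum]
  refine Finset.sum_congr rfl fun p _ => Finset.sum_congr rfl fun q _ => ?_
  have e1 : (X : ℝ[X]) ^ e * (C ((r : ℝ) ^ p * (l : ℝ) ^ q /
      ((p.factorial : ℝ) * (q.factorial : ℝ))) * w p q) =
    C (1 / ((p.factorial : ℝ) * (q.factorial : ℝ))) * C (r : ℝ) ^ p * C (l : ℝ) ^ q *
      (X ^ e * w p q) := by
    rw [← C_pow, ← C_pow, ← C_mul, ← C_mul, mul_left_comm]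
    congr 2
    ring
  rw [e1, map_mul, ← h, map_mul, map_mul, map_pow, map_pow, ← const_eq, ← const_eq, ← const_eq]
  ring

/-- Divisibility by `X ^ (m + n)` turns `O(h^6)` into conditions on the coefficients of degree `k ≤
5 - m - n` of `nodeMoment`. -/
lemma momentI_eq (c : Stencil) (m n : ℕ) : momentI a b d₁ d₂ ρ c m n =
    toLaurent (X ^ (m + n) * nodeMoment c (uPoly a b d₁ d₂ ρ m n)) := by
  simp only [momentI, nodeMoment, G5, taylorFive_eq (uCoeff_eq a b d₁ d₂ ρ m n), stencilPoly_eq,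
    Finset.mul_sum, map_sum, ← map_mul, mul_left_comm]

lemma momentJ_eq (c : Stencil) (m n : ℕ) : momentJ a b d₁ d₂ ρ c m n =
    toLaurent (X ^ (m + n + 2) * nodeMoment c (fPoly a b d₁ d₂ ρ m n)) := by
  simp only [momentJ, nodeMoment, H5, taylorFive_eq (fCoeff_eq a b d₁ d₂ ρ m n), stencilPoly_eq,
    Finset.mul_sum, map_sum, ← map_mul, mul_left_comm]

lemma coeff_toLaurent_natCast (P : ℝ[X]) (k : ℕ) : (toLaurent P).coeff (k : ℤ) = P.coeff k := by
  rw [toLaurent_apply]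
  exact Finsupp.mapDomain_apply Nat.cast_injective _ _

lemma coeff_toLaurent_of_neg (P : ℝ[X]) {k : ℤ} (hk : k < 0) : (toLaurent P).coeff k = 0 := by
  rw [toLaurent_apply]
  refine Finsupp.mapDomain_of_notMem_range _ _ ?_
  rintro ⟨n, rfl⟩
  exact absurd hk (not_lt.2 (Int.natCast_nonneg n))

end Scaled

/-! ### Linear algebra on the nine nodes -/

section Nodes

lemma sum_offs (f : ℤ → ℝ) : ∑ r ∈ offs, f r = f (-1) + f 0 + f 1 := by
  have : offs = {-1, 0, 1} := by decide
  rw [this]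
  simp [add_assoc]

lemma mem_offs {r : ℤ} : r ∈ offs ↔ r = -1 ∨ r = 0 ∨ r = 1 := by
  rw [offs, Finset.mem_Icc]
  omega

/-- The function on the nodes with given values in lexicographic order, zero elsewhere. -/
def nodeVec (A B C D E F G H I : ℝ) (r l : ℤ) : ℝ :=
  if r = -1 then (if l = -1 then A else if l = 0 then B else if l = 1 then C else 0)
  else if r = 0 then (if l = -1 then D else if l = 0 then E else if l = 1 then F else 0)
  else if r = 1 then (if l = -1 then G else if l = 0 then H else if l = 1 then I else 0)
  else 0

/-- A function on the nodes vanishing at all nodes which carry no coefficient of degree `k`. -/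
structure Vanishes (k : ℕ) (v : ℤ → ℤ → ℝ) : Prop where
  support : ∀ r l, ¬ (r ∈ offs ∧ l ∈ offs) → v r l = 0
  one_one : 1 ≤ k → v 1 1 = 0
  one_zero : 2 ≤ k → v 1 0 = 0
  zero_one : 3 ≤ k → v 0 1 = 0
  one_neg : 3 ≤ k → v 1 (-1) = 0
  neg_one : 4 ≤ k → v (-1) 1 = 0
  zero_zero : 4 ≤ k → v 0 0 = 0
  neg_zero : 5 ≤ k → v (-1) 0 = 0
  zero_neg : 5 ≤ k → v 0 (-1) = 0
  neg_neg : 6 ≤ k → v (-1) (-1) = 0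

lemma Vanishes.ext {k : ℕ} {v v' : ℤ → ℤ → ℝ} (hv : Vanishes k v) (hv' : Vanishes k v')
    (h : ∀ r ∈ offs, ∀ l ∈ offs, v r l = v' r l) : v = v' := by
  funext r l
  by_cases hr : r ∈ offs ∧ l ∈ offs
  · exact h r hr.1 l hr.2
  · rw [hv.support r l hr, hv'.support r l hr]

/-- The solution of the recursion `w (p + 2) q = s p q - w p (q + 2)` for harmonic functions. -/
def flatJet (g₀ g₁ : ℕ → ℝ) (s : ℕ → ℕ → ℝ) (p q : ℕ) : ℝ :=
  elimRing (fun _ _ => 0) (fun _ _ => 0) (fun _ _ => 0) g₀ g₁ s p q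

@[simp] lemma flatJet_zero (g₀ g₁ : ℕ → ℝ) (s : ℕ → ℕ → ℝ) (q : ℕ) :
    flatJet g₀ g₁ s 0 q = g₀ q := elimRing_zero q

@[simp] lemma flatJet_one (g₀ g₁ : ℕ → ℝ) (s : ℕ → ℕ → ℝ) (q : ℕ) :
    flatJet g₀ g₁ s 1 q = g₁ q := elimRing_one q

lemma flatJet_add_two (g₀ g₁ : ℕ → ℝ) (s : ℕ → ℕ → ℝ) (p q : ℕ) :
    flatJet g₀ g₁ s (p + 2) q = s p q - flatJet g₀ g₁ s p (q + 2) := by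
  rw [flatJet, elimRing_add_two, elimStep]
  simp [flatJet]

lemma flatJet_two (g₀ g₁ : ℕ → ℝ) (s : ℕ → ℕ → ℝ) (q : ℕ) :
    flatJet g₀ g₁ s 2 q = s 0 q - g₀ (q + 2) := by
  rw [flatJet_add_two, flatJet_zero]

lemma flatJet_three (g₀ g₁ : ℕ → ℝ) (s : ℕ → ℕ → ℝ) (q : ℕ) :
    flatJet g₀ g₁ s 3 q = s 1 q - g₁ (q + 2) := by
  rw [flatJet_add_two, flatJet_one]

lemma flatJet_four (g₀ g₁ : ℕ → ℝ) (s : ℕ → ℕ → ℝ) (q : ℕ) :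
    flatJet g₀ g₁ s 4 q = s 2 q - (s 0 (q + 2) - g₀ (q + 4)) := by
  rw [flatJet_add_two, flatJet_two]

lemma flatJet_five (g₀ g₁ : ℕ → ℝ) (s : ℕ → ℕ → ℝ) (q : ℕ) :
    flatJet g₀ g₁ s 5 q = s 3 q - (s 1 (q + 2) - g₁ (q + 4)) := by
  rw [flatJet_add_two, flatJet_three]

/-- The value at the node `(r, l)` of the Taylor polynomial with real derivatives `w`. -/
def realTaylor (w : ℕ → ℕ → ℝ) (r l : ℤ) : ℝ :=
  ∑ p ∈ Finset.range 6, ∑ q ∈ Finset.range (6 - p),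
    (r : ℝ) ^ p * (l : ℝ) ^ q / ((p.factorial : ℝ) * (q.factorial : ℝ)) * w p q

/-- The harmonic polynomial with `u^{(m,n)} = 1`, all other `u^{(0,q)}`, `u^{(1,q)}` zero. -/
def harm (m n : ℕ) (r l : ℤ) : ℝ :=
  realTaylor (flatJet (fun k => if m = 0 ∧ k = n then 1 else 0)
    (fun k => if m = 1 ∧ k = n then 1 else 0) (fun _ _ => 0)) r l

/-- Moment of a function on the nodes against a harmonic polynomial. -/
def pairing (v : ℤ → ℤ → ℝ) (m n : ℕ) : ℝ := ∑ r ∈ offs, ∑ l ∈ offs, v r l * harm m n r l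

/-! ### Explicit harmonic polynomials on the nodes -/

lemma harm_0_0 (r l : ℤ) : harm 0 0 r l = 1 := by
  simp [harm, realTaylor, Finset.sum_range_succ, flatJet_two, flatJet_three, flatJet_four,
    flatJet_five, Nat.factorial]
  try ring

lemma harm_0_1 (r l : ℤ) : harm 0 1 r l = l := by
  simp [harm, realTaylor, Finset.sum_range_succ, flatJet_two, flatJet_three, flatJet_four,
    flatJet_five, Nat.factorial]
  try ring

lemma harm_1_0 (r l : ℤ) : harm 1 0 r l = r := by
  simp [harm, realTaylor, Finset.sum_range_succ, flatJet_two, flatJet_three, flatJet_four,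
    flatJet_five, Nat.factorial]
  try ring

lemma harm_0_2 (r l : ℤ) : harm 0 2 r l = (l : ℝ) ^ 2 / 2 - (r : ℝ) ^ 2 / 2 := by
  simp [harm, realTaylor, Finset.sum_range_succ, flatJet_two, flatJet_three, flatJet_four,
    flatJet_five, Nat.factorial]
  try ring

lemma harm_1_1 (r l : ℤ) : harm 1 1 r l = r * l := by
  simp [harm, realTaylor, Finset.sum_range_succ, flatJet_two, flatJet_three, flatJet_four,
    flatJet_five, Nat.factorial]
  try ring

lemma harm_0_3 (r l : ℤ) : harm 0 3 r l = (l : ℝ) ^ 3 / 6 - (r : ℝ) ^ 2 * l / 2 := by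
  simp [harm, realTaylor, Finset.sum_range_succ, flatJet_two, flatJet_three, flatJet_four,
    flatJet_five, Nat.factorial]
  try ring

lemma harm_1_2 (r l : ℤ) : harm 1 2 r l = r * (l : ℝ) ^ 2 / 2 - (r : ℝ) ^ 3 / 6 := by
  simp [harm, realTaylor, Finset.sum_range_succ, flatJet_two, flatJet_three, flatJet_four,
    flatJet_five, Nat.factorial]
  try ring

lemma harm_0_4 (r l : ℤ) : harm 0 4 r l = (l : ℝ) ^ 4 / 24 - (r : ℝ) ^ 2 * (l : ℝ) ^ 2 / 4 + (r :
  ℝ) ^ 4 / 24 := by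
  simp [harm, realTaylor, Finset.sum_range_succ, flatJet_two, flatJet_three, flatJet_four,
    flatJet_five, Nat.factorial]
  try ring

lemma harm_1_3 (r l : ℤ) : harm 1 3 r l = r * (l : ℝ) ^ 3 / 6 - (r : ℝ) ^ 3 * l / 6 := by
  simp [harm, realTaylor, Finset.sum_range_succ, flatJet_two, flatJet_three, flatJet_four,
    flatJet_five, Nat.factorial]
  try ring

lemma harm_0_5 (r l : ℤ) : harm 0 5 r l = (l : ℝ) ^ 5 / 120 - (r : ℝ) ^ 2 * (l : ℝ) ^ 3 / 12 + (r
  : ℝ) ^ 4 * l / 24 := by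
  simp [harm, realTaylor, Finset.sum_range_succ, flatJet_two, flatJet_three, flatJet_four,
    flatJet_five, Nat.factorial]
  try ring

lemma harm_1_4 (r l : ℤ) : harm 1 4 r l = r * (l : ℝ) ^ 4 / 24 - (r : ℝ) ^ 3 * (l : ℝ) ^ 2 / 12 +
  (r : ℝ) ^ 5 / 120 := by
  simp [harm, realTaylor, Finset.sum_range_succ, flatJet_two, flatJet_three, flatJet_four,
    flatJet_five, Nat.factorial]
  try ring

/-- The coefficients of the nine-point Laplacian. -/
def nineLap : ℤ → ℤ → ℝ :=
  nodeVec (1 / 6) (2 / 3) (1 / 6) (2 / 3) (-10 / 3) (2 / 3) (1 / 6) (2 / 3) (1 / 6)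

/-- The function on the nodes with moments `R` which is free of degree `k`. -/
def solveLevel : ℕ → (ℕ → ℕ → ℝ) → ℤ → ℤ → ℝ
  -- Each branch is the inverse of the square system formed by the entries left free at that level
  -- and the moments with `k + m + n ≤ 5`. At level one `R 1 3` is absent, that moment being
  -- identically zero.
  | 1, R => nodeVec
      (-1 / 6 * R 0 1 + R 0 3 - 1 / 6 * R 1 0 - R 1 2)
      (-1 / 3 * R 0 1 - 1 / 2 * R 0 2 + 2 * R 0 3 + 6 * R 0 4 - 2 / 3 * R 1 0 - R 1 1 - R 1 2)
      (-1 / 6 * R 1 0 - 1 / 2 * R 1 1 - R 1 2)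
      (-2 / 3 * R 0 1 + 1 / 2 * R 0 2 + R 0 3 + 6 * R 0 4 - 1 / 3 * R 1 0 - R 1 1 - 2 * R 1 2)
      (R 0 0 + 5 / 3 * R 0 1 - 10 * R 0 3 - 24 * R 0 4 + 5 / 3 * R 1 0 + 5 * R 1 1 + 10 * R 1 2)
      (1 / 2 * R 0 2 + 3 * R 0 3 + 6 * R 0 4 - 1 / 3 * R 1 0 - R 1 1 - 2 * R 1 2)
      (-1 / 6 * R 0 1 + R 0 3 - 1 / 2 * R 1 1)
      (-1 / 3 * R 0 1 - 1 / 2 * R 0 2 + 2 * R 0 3 + 6 * R 0 4 - R 1 1 - 3 * R 1 2)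
      0
  | 2, R => nodeVec
      (-1 / 6 * R 0 1 + R 0 3 - 1 / 6 * R 1 0 - R 1 2)
      (-2 / 3 * R 1 0 + 2 * R 1 2)
      (-1 / 6 * R 1 0 - 1 / 2 * R 1 1 - R 1 2)
      (-1 / 3 * R 0 1 + R 0 2 - R 0 3 - 1 / 3 * R 1 0 + R 1 2)
      (R 0 0 + 1 / 3 * R 0 1 - 2 * R 0 2 - 2 * R 0 3 + 5 / 3 * R 1 0 + R 1 1 - 2 * R 1 2)
      (1 / 3 * R 0 1 + R 0 2 + R 0 3 - 1 / 3 * R 1 0 + R 1 2)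
      (-1 / 6 * R 0 1 + R 0 3 - 1 / 2 * R 1 1)
      0
      0
  | 3, R => nodeVec
      (1 / 2 * R 0 1 + R 0 2 - 1 / 2 * R 1 0 + R 1 1)
      (-R 0 1 - 2 * R 0 2 - R 1 1)
      (1 / 2 * R 0 1 + R 0 2 - 1 / 2 * R 1 0)
      (-R 0 1 - R 1 1)
      (R 0 0 + R 0 1 + R 1 0 + R 1 1)
      0
      0
      0
      0
  | 4, R => nodeVec
      (-R 0 0 - R 0 1 - R 1 0)
      (R 0 0 + R 0 1)
      0
      (R 0 0 + R 1 0)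
      0
      0
      0
      0
      0
  | 5, R => nodeVec
      (R 0 0)
      0
      0
      0
      0
      0
      0
      0
      0
  | _, _ => fun _ _ => 0

@[simp] lemma nodeVec_neg_neg (A B C D E F G H I : ℝ) :
    nodeVec A B C D E F G H I (-1) (-1) = A := rfl

@[simp] lemma nodeVec_neg_zero (A B C D E F G H I : ℝ) :
    nodeVec A B C D E F G H I (-1) 0 = B := rfl

@[simp] lemma nodeVec_neg_one (A B C D E F G H I : ℝ) :
    nodeVec A B C D E F G H I (-1) 1 = C := rfl

@[simp] lemma nodeVec_zero_neg (A B C D E F G H I : ℝ) :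
    nodeVec A B C D E F G H I 0 (-1) = D := rfl

@[simp] lemma nodeVec_zero_zero (A B C D E F G H I : ℝ) :
    nodeVec A B C D E F G H I 0 0 = E := rfl

@[simp] lemma nodeVec_zero_one (A B C D E F G H I : ℝ) :
    nodeVec A B C D E F G H I 0 1 = F := rfl

@[simp] lemma nodeVec_one_neg (A B C D E F G H I : ℝ) :
    nodeVec A B C D E F G H I 1 (-1) = G := rfl

@[simp] lemma nodeVec_one_zero (A B C D E F G H I : ℝ) :
    nodeVec A B C D E F G H I 1 0 = H := rfl

@[simp] lemma nodeVec_one_one (A B C D E F G H I : ℝ) :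
    nodeVec A B C D E F G H I 1 1 = I := rfl

/-! ### Moments of node functions and inversion of the level systems -/

lemma pairing_0_0 (v : ℤ → ℤ → ℝ) : pairing v 0 0 =
    v (-1) (-1) + v (-1) 0 + v (-1) 1 + v 0 (-1) + v 0 0 + v 0 1 + v 1 (-1) + v 1 0 + v 1 1 := by
  norm_num [pairing, sum_offs, harm_0_0]
  try ring

lemma pairing_0_1 (v : ℤ → ℤ → ℝ) : pairing v 0 1 =
    -v (-1) (-1) + v (-1) 1 - v 0 (-1) + v 0 1 - v 1 (-1) + v 1 1 := by
  norm_num [pairing, sum_offs, harm_0_1]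
  try ring

lemma pairing_0_2 (v : ℤ → ℤ → ℝ) : pairing v 0 2 =
    -1 / 2 * v (-1) 0 + 1 / 2 * v 0 (-1) + 1 / 2 * v 0 1 - 1 / 2 * v 1 0 := by
  norm_num [pairing, sum_offs, harm_0_2]
  try ring

lemma pairing_0_3 (v : ℤ → ℤ → ℝ) : pairing v 0 3 =
    1 / 3 * v (-1) (-1) - 1 / 3 * v (-1) 1 - 1 / 6 * v 0 (-1) + 1 / 6 * v 0 1 + 1 / 3 * v 1
      (-1) - 1 / 3 * v 1 1 := by
  norm_num [pairing, sum_offs, harm_0_3]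
  try ring

lemma pairing_0_4 (v : ℤ → ℤ → ℝ) : pairing v 0 4 =
    -1 / 6 * v (-1) (-1) + 1 / 24 * v (-1) 0 - 1 / 6 * v (-1) 1 + 1 / 24 * v 0 (-1) + 1 / 24 *
      v 0 1 - 1 / 6 * v 1 (-1) + 1 / 24 * v 1 0 - 1 / 6 * v 1 1 := by
  norm_num [pairing, sum_offs, harm_0_4]
  try ring

lemma pairing_0_5 (v : ℤ → ℤ → ℝ) : pairing v 0 5 =
    1 / 30 * v (-1) (-1) - 1 / 30 * v (-1) 1 - 1 / 120 * v 0 (-1) + 1 / 120 * v 0 1 + 1 / 30 *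
      v 1 (-1) - 1 / 30 * v 1 1 := by
  norm_num [pairing, sum_offs, harm_0_5]
  try ring

lemma pairing_1_0 (v : ℤ → ℤ → ℝ) : pairing v 1 0 =
    -v (-1) (-1) - v (-1) 0 - v (-1) 1 + v 1 (-1) + v 1 0 + v 1 1 := by
  norm_num [pairing, sum_offs, harm_1_0]
  try ring

lemma pairing_1_1 (v : ℤ → ℤ → ℝ) : pairing v 1 1 =
    v (-1) (-1) - v (-1) 1 - v 1 (-1) + v 1 1 := by
  norm_num [pairing, sum_offs, harm_1_1]
  try ring

lemma pairing_1_2 (v : ℤ → ℤ → ℝ) : pairing v 1 2 =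
    -1 / 3 * v (-1) (-1) + 1 / 6 * v (-1) 0 - 1 / 3 * v (-1) 1 + 1 / 3 * v 1 (-1) - 1 / 6 * v
      1 0 + 1 / 3 * v 1 1 := by
  norm_num [pairing, sum_offs, harm_1_2]
  try ring

/-- The polynomial is `r l (l² - r²) / 6`, which vanishes at all nine nodes. -/
lemma pairing_1_3 (v : ℤ → ℤ → ℝ) : pairing v 1 3 =
    0 := by
  norm_num [pairing, sum_offs, harm_1_3]
  try ring

lemma pairing_1_4 (v : ℤ → ℤ → ℝ) : pairing v 1 4 =
    1 / 30 * v (-1) (-1) - 1 / 120 * v (-1) 0 + 1 / 30 * v (-1) 1 - 1 / 30 * v 1 (-1) + 1 /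
      120 * v 1 0 - 1 / 30 * v 1 1 := by
  norm_num [pairing, sum_offs, harm_1_4]
  try ring

lemma nodeVec_support (A B C D E F G H I : ℝ) (r l : ℤ) (h : ¬ (r ∈ offs ∧ l ∈ offs)) :
    nodeVec A B C D E F G H I r l = 0 := by
  simp only [mem_offs] at h
  unfold nodeVec
  split_ifs <;> first | rfl | (exfalso; omega)

lemma Vanishes.solveLevel {k : ℕ} (hk : 1 ≤ k) (R : ℕ → ℕ → ℝ) :
    Vanishes k (CompactFDM.solveLevel k R) := by
  match k, hk with
  | 1, _ | 2, _ | 3, _ | 4, _ | 5, _ =>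
    constructor
    · exact nodeVec_support _ _ _ _ _ _ _ _ _
    all_goals first | exact fun _ => rfl | (intro h; omega)
  | k + 6, _ => constructor <;> intros <;> rfl

lemma Vanishes.eq_zero {k : ℕ} (hk : 6 ≤ k) {v : ℤ → ℤ → ℝ} (hv : Vanishes k v) :
    v = fun _ _ => 0 := by
  funext r l
  by_cases h : r ∈ offs ∧ l ∈ offs
  · obtain ⟨h0, h1, h2, h3, h4, h5, h6, h7, h8, h9⟩ := hv
    simp only [mem_offs] at h
    obtain ⟨rfl | rfl | rfl, rfl | rfl | rfl⟩ := h <;> first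
      | exact h1 (by omega) | exact h2 (by omega) | exact h3 (by omega) | exact h4 (by omega)
      | exact h5 (by omega) | exact h6 (by omega) | exact h7 (by omega) | exact h8 (by omega)
      | exact h9 (by omega)
  · exact hv.support r l h

/-- The uniqueness half: the moments determine a node function with the prescribed zeros. -/
lemma solveLevel_pairing {k : ℕ} (hk : 1 ≤ k) {v : ℤ → ℤ → ℝ} (hv : Vanishes k v) :
    solveLevel k (pairing v) = v := by
  match k, hk, hv with
  | 1, _, hv | 2, _, hv | 3, _, hv | 4, _, hv | 5, _, hv =>
    refine Vanishes.ext (Vanishes.solveLevel (by omega) _) hv fun r hr l hl => ?_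
    obtain ⟨h0, h1, h2, h3, h4, h5, h6, h7, h8, -⟩ := hv
    norm_num at h1 h2 h3 h4 h5 h6 h7 h8
    rw [mem_offs] at hr hl
    rcases hr with rfl | rfl | rfl <;> rcases hl with rfl | rfl | rfl <;>
      simp only [solveLevel, nodeVec_neg_neg, nodeVec_neg_zero, nodeVec_neg_one, nodeVec_zero_neg,
      nodeVec_zero_zero, nodeVec_zero_one, nodeVec_one_neg, nodeVec_one_zero,
      nodeVec_one_one, pairing_0_0, pairing_0_1, pairing_0_2, pairing_0_3, pairing_0_4,
      pairing_1_0, pairing_1_1, pairing_1_2] <;>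
      linarith
  | k + 6, _, hv => exact (Vanishes.eq_zero (by omega) hv).symm

lemma solveLevel_congr {k : ℕ} (hk : 1 ≤ k) {R R' : ℕ → ℕ → ℝ}
    (h : ∀ m n, m ≤ 1 → k + m + n ≤ 5 → R m n = R' m n) : solveLevel k R = solveLevel k R' := by
  match k, hk with
  | 1, _ | 2, _ | 3, _ | 4, _ | 5, _ =>
    simp (disch := omega) only [solveLevel, h]
  | k + 6, _ => rfl

/-- The existence half. Since the moment `(1, 3)` is always zero, `hR` is the compatibility
condition of the one redundant equation. -/
lemma pairing_solveLevel {k m n : ℕ} (hk : 1 ≤ k) (hm : m ≤ 1) (h : k + m + n ≤ 5)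
    (R : ℕ → ℕ → ℝ) (hR : k = 1 → m = 1 → n = 3 → R m n = 0) :
    pairing (solveLevel k R) m n = R m n := by
  have h5 : k ≤ 5 := by omega
  have hn : n ≤ 4 := by omega
  interval_cases k <;> interval_cases m <;> interval_cases n <;>
    first
    | omega
    | rw [hR rfl rfl rfl, pairing_1_3]
    | (simp only [solveLevel, nodeVec_neg_neg, nodeVec_neg_zero, nodeVec_neg_one, nodeVec_zero_neg,
      nodeVec_zero_zero, nodeVec_zero_one, nodeVec_one_neg, nodeVec_one_zero,
      nodeVec_one_one, pairing_0_0, pairing_0_1, pairing_0_2, pairing_0_3, pairing_0_4,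
      pairing_1_0, pairing_1_1, pairing_1_2]; ring)

lemma nineLap_vanishes : Vanishes 0 nineLap := by
  constructor
  · exact nodeVec_support _ _ _ _ _ _ _ _ _
  all_goals (intro h; omega)

lemma pairing_nineLap {m n : ℕ} (hm : m ≤ 1) (h : m + n ≤ 5) : pairing nineLap m n = 0 := by
  have hn : n ≤ 5 := by omega
  interval_cases m <;> interval_cases n <;>
    first
    | omega
    | (simp only [nineLap, nodeVec_neg_neg, nodeVec_neg_zero, nodeVec_neg_one, nodeVec_zero_neg,
      nodeVec_zero_zero, nodeVec_zero_one, nodeVec_one_neg, nodeVec_one_zero,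
      nodeVec_one_one, pairing_0_0, pairing_0_1, pairing_0_2, pairing_0_3, pairing_0_4, pairing_0_5,
      pairing_1_0, pairing_1_1, pairing_1_2, pairing_1_3, pairing_1_4] <;> norm_num)

/-- Eight of the eleven moments are independent on the nine nodes, so their common kernel is a line
and the central value picks one element. -/
lemma eq_nineLap {v : ℤ → ℤ → ℝ} (hv : Vanishes 0 v) (hc : v 0 0 = -10 / 3)
    (h : ∀ m n, m ≤ 1 → m + n ≤ 5 → pairing v m n = 0) : v = nineLap := by
  have e00 := h 0 0 (by omega) (by omega)
  have e01 := h 0 1 (by omega) (by omega)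
  have e02 := h 0 2 (by omega) (by omega)
  have e03 := h 0 3 (by omega) (by omega)
  have e04 := h 0 4 (by omega) (by omega)
  have e10 := h 1 0 (by omega) (by omega)
  have e11 := h 1 1 (by omega) (by omega)
  have e12 := h 1 2 (by omega) (by omega)
  simp only [pairing_0_0, pairing_0_1, pairing_0_2, pairing_0_3, pairing_0_4,
      pairing_1_0, pairing_1_1, pairing_1_2] at e00 e01 e02 e03 e04 e10 e11 e12
  refine hv.ext nineLap_vanishes fun r hr l hl => ?_
  rw [mem_offs] at hr hl
  rcases hr with rfl | rfl | rfl <;> rcases hl with rfl | rfl | rfl <;>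
    simp only [nineLap, nodeVec_neg_neg, nodeVec_neg_zero, nodeVec_neg_one, nodeVec_zero_neg,
      nodeVec_zero_zero, nodeVec_zero_one, nodeVec_one_neg, nodeVec_one_zero,
      nodeVec_one_one] <;> linarith

end Nodes

/-! ### Existence and uniqueness of the stencil -/

section Scheme

open Polynomial

variable {a b d₁ d₂ : ℕ → ℕ → ℝ} {ρ : ℝ}

lemma coeff_stencilPolynomial (c : Stencil) (r l : ℤ) {k : ℕ} (hk : k ≤ 5) :
    (stencilPolynomial c r l).coeff k = c r l k := by
  simp only [stencilPolynomial, finsetSum_coeff, coeff_C_mul_X_pow]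
  rw [Finset.sum_ite_eq]
  simp [Nat.lt_succ_of_le hk]

lemma coeff_nodeTaylor (w : ℕ → ℕ → ℝ[X]) (r l : ℤ) (k : ℕ) :
    (nodeTaylor w r l).coeff k = realTaylor (fun p q => (w p q).coeff k) r l := by
  simp only [nodeTaylor, realTaylor, finsetSum_coeff, coeff_C_mul]

lemma coeff_nodeMoment (c : Stencil) (w : ℕ → ℕ → ℝ[X]) {k : ℕ} (hk : k ≤ 5) :
    (nodeMoment c w).coeff k = ∑ i ∈ Finset.range (k + 1), ∑ r ∈ offs, ∑ l ∈ offs,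
      c r l i * (nodeTaylor w r l).coeff (k - i) := by
  simp only [nodeMoment, finsetSum_coeff, coeff_mul,
    Finset.Nat.sum_antidiagonal_eq_sum_range_succ_mk]
  rw [Finset.sum_comm]
  conv_lhs => enter [2, y]; rw [Finset.sum_comm]
  rw [Finset.sum_comm]
  refine Finset.sum_congr rfl fun i hi => ?_
  rw [Finset.sum_comm]
  refine Finset.sum_congr rfl fun r _ => Finset.sum_congr rfl fun l _ => ?_
  rw [Finset.mem_range] at hi
  rw [coeff_stencilPolynomial c r l (by omega)]

/-- Every scaled coefficient carries a positive power of `h`; at `h = 0` only the Poisson recursion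
remains. -/
lemma coeff_zero_elimRing (g₀ g₁ : ℕ → ℝ[X]) (s : ℕ → ℕ → ℝ[X]) (p q : ℕ) :
    (elimRing (scaledFirst a) (scaledFirst b) (scaledReaction d₁ d₂ ρ) g₀ g₁ s p q).coeff 0 =
      flatJet (fun q => (g₀ q).coeff 0) (fun q => (g₁ q).coeff 0) (fun i j => (s i j).coeff 0)
        p q := by
  rw [← constantCoeff_apply, map_elimRing, flatJet]
  simp [scaledFirst, scaledReaction]

lemma coeff_zero_nodeTaylor_uPoly (m n : ℕ) (r l : ℤ) :
    (nodeTaylor (uPoly a b d₁ d₂ ρ m n) r l).coeff 0 = harm m n r l := by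
  simp only [coeff_nodeTaylor, uPoly, coeff_zero_elimRing, harm, apply_ite (fun P => coeff P 0),
    coeff_one_zero, coeff_zero]

/-- The stencil coefficients, solved degree by degree; `Γ m n r l k` is the coefficient of `h^k`
in the value of the scaled function `G_{m,n}` at the node `(r, l)`. -/
def schemeCoeff (Γ : ℕ → ℕ → ℤ → ℤ → ℕ → ℝ) : ℕ → ℤ → ℤ → ℝ
  | 0 => nineLap
  | k + 1 => solveLevel (k + 1) fun m n =>
      -∑ i : Fin (k + 1), ∑ r ∈ offs, ∑ l ∈ offs, schemeCoeff Γ i r l * Γ m n r l (k + 1 - i)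

lemma schemeCoeff_vanishes (Γ : ℕ → ℕ → ℤ → ℤ → ℕ → ℝ) (k : ℕ) :
    Vanishes k (schemeCoeff Γ k) := by
  cases k with
  | zero => rw [schemeCoeff]; exact nineLap_vanishes
  | succ k => rw [schemeCoeff]; exact Vanishes.solveLevel (by omega) _

/-- The coefficients of the scaled functions `G_{m,n}` at the nodes. -/
def nodeCoeff (a b d₁ d₂ : ℕ → ℕ → ℝ) (ρ : ℝ) (m n : ℕ) (r l : ℤ) (k : ℕ) : ℝ :=
  (nodeTaylor (uPoly a b d₁ d₂ ρ m n) r l).coeff k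

/-- The stencil of the scheme. -/
def theStencil (a b d₁ d₂ : ℕ → ℕ → ℝ) (ρ : ℝ) : Stencil :=
  fun r l k => schemeCoeff (nodeCoeff a b d₁ d₂ ρ) k r l

/-- The triangular structure: level `k` enters only through moments against harmonic polynomials,
everything else comes from lower levels. -/
lemma coeff_nodeMoment_uPoly (c : Stencil) (m n : ℕ) {k : ℕ} (hk : k ≤ 5) :
    (nodeMoment c (uPoly a b d₁ d₂ ρ m n)).coeff k = pairing (fun r l => c r l k) m n +
      ∑ i : Fin k, ∑ r ∈ offs, ∑ l ∈ offs,
        c r l i * nodeCoeff a b d₁ d₂ ρ m n r l (k - i) := by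
  rw [coeff_nodeMoment c _ hk, Finset.sum_range_succ, add_comm, Finset.sum_range]
  simp only [tsub_self, coeff_zero_nodeTaylor_uPoly, pairing, nodeCoeff]

/-- The reduced conditions on the stencil. -/
structure IsReduced (a b d₁ d₂ : ℕ → ℕ → ℝ) (ρ : ℝ) (c : Stencil) : Prop where
  vanishes : ∀ k, Vanishes k fun r l => c r l k
  moment : ∀ m n k, m ≤ 1 → k + m + n ≤ 5 → (nodeMoment c (uPoly a b d₁ d₂ ρ m n)).coeff k = 0
  center : c 0 0 0 = -10 / 3

lemma IsReduced.eq_theStencil {c : Stencil} (hc : IsReduced a b d₁ d₂ ρ c) :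
    c = theStencil a b d₁ d₂ ρ := by
  suffices h : ∀ k, (fun r l => c r l k) = schemeCoeff (nodeCoeff a b d₁ d₂ ρ) k by
    funext r l k
    exact congrFun (congrFun (h k) r) l
  intro k
  induction k using Nat.strong_induction_on with
  | _ k ih =>
    cases k with
    | zero =>
      rw [schemeCoeff]
      refine eq_nineLap (hc.vanishes 0) hc.center fun m n hm hmn => ?_
      have := hc.moment m n 0 hm (by omega)
      rw [coeff_nodeMoment_uPoly c m n (by omega)] at this
      simpa using this
    | succ k =>
      rcases le_or_gt 6 (k + 1) with hk | hk
      · rw [(hc.vanishes (k + 1)).eq_zero hk, (schemeCoeff_vanishes _ (k + 1)).eq_zero hk]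
      · rw [← solveLevel_pairing (by omega) (hc.vanishes (k + 1)), schemeCoeff]
        refine solveLevel_congr (by omega) fun m n hm hmn => ?_
        have := hc.moment m n (k + 1) hm (by omega)
        rw [coeff_nodeMoment_uPoly c m n (by omega)] at this
        rw [eq_neg_of_add_eq_zero_left this]
        congr 1
        refine Finset.sum_congr rfl fun i _ => Finset.sum_congr rfl fun r _ =>
          Finset.sum_congr rfl fun l _ => ?_
        rw [← ih i (by omega)]

/-- Below order `m + n` the free entry `u^{(m,n)}` is not seen. At order `m + n` the lower order
terms therefore drop out, leaving `u_xx = -u_yy` with constant coefficients. -/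
lemma uPoly_of_le (m n p : ℕ) : ∀ q, p + q ≤ m + n →
    (∃ r, uPoly a b d₁ d₂ ρ m n p q = C r) ∧ (p + q < m + n → uPoly a b d₁ d₂ ρ m n p q = 0) := by
  induction p using Nat.strong_induction_on with
  | _ p ih =>
    intro q hpq
    match p, ih, hpq with
    | 0, _, hpq =>
      rw [uPoly, elimRing_zero]
      split_ifs with h
      · exact ⟨⟨1, by simp⟩, fun h' => by omega⟩
      · exact ⟨⟨0, by simp⟩, fun _ => rfl⟩
    | 1, _, hpq =>
      rw [uPoly, elimRing_one]
      split_ifs with h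
      · exact ⟨⟨1, by simp⟩, fun h' => by omega⟩
      · exact ⟨⟨0, by simp⟩, fun _ => rfl⟩
    | p + 2, ih, hpq =>
      have key : uPoly a b d₁ d₂ ρ m n (p + 2) q = -uPoly a b d₁ d₂ ρ m n p (q + 2) := by
        unfold uPoly
        rw [elimRing_add_two, elimStep, zero_sub, sub_eq_self]
        refine Finset.sum_eq_zero fun i _ => Finset.sum_eq_zero fun j _ => ?_
        have hi := i.2
        have hj := j.2
        have e1 := (ih (p + 1 - i) (by omega) (q - j) (by omega)).2 (by omega)
        have e2 := (ih (p - i) (by omega) (q + 1 - j) (by omega)).2 (by omega)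
        have e3 := (ih (p - i) (by omega) (q - j) (by omega)).2 (by omega)
        unfold uPoly at e1 e2 e3
        rw [e1, e2, e3]
        ring
      obtain ⟨⟨r, hr⟩, h0⟩ := ih p (by omega) (q + 2) (by omega)
      rw [key]
      exact ⟨⟨-r, by rw [hr, C_neg]⟩, fun h => by rw [h0 (by omega), neg_zero]⟩

/-- Only monomials of degree five remain; they are odd under `(r, l) ↦ (-r, -l)`, while `nineLap` is
even. -/
lemma nineLap_realTaylor_eq_zero (y : ℕ → ℕ → ℝ) (hy : ∀ p q, p + q ≤ 4 → y p q = 0) :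
    ∑ r ∈ offs, ∑ l ∈ offs, nineLap r l * realTaylor y r l = 0 := by
  have h00 := hy 0 0 (by norm_num)
  have h01 := hy 0 1 (by norm_num)
  have h02 := hy 0 2 (by norm_num)
  have h03 := hy 0 3 (by norm_num)
  have h04 := hy 0 4 (by norm_num)
  have h10 := hy 1 0 (by norm_num)
  have h11 := hy 1 1 (by norm_num)
  have h12 := hy 1 2 (by norm_num)
  have h13 := hy 1 3 (by norm_num)
  have h20 := hy 2 0 (by norm_num)
  have h21 := hy 2 1 (by norm_num)
  have h22 := hy 2 2 (by norm_num)
  have h30 := hy 3 0 (by norm_num)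
  have h31 := hy 3 1 (by norm_num)
  have h40 := hy 4 0 (by norm_num)
  simp only [sum_offs, nineLap, nodeVec_neg_neg, nodeVec_neg_zero, nodeVec_neg_one,
    nodeVec_zero_neg, nodeVec_zero_zero, nodeVec_zero_one, nodeVec_one_neg, nodeVec_one_zero,
    nodeVec_one_one, realTaylor, Finset.sum_range_succ, Finset.sum_range_zero, Nat.reduceSub, h00,
    h01, h02, h03, h04, h10, h11, h12, h13, h20, h21, h22, h30, h31, h40]
  push_cast
  ring

lemma isReduced_theStencil : IsReduced a b d₁ d₂ ρ (theStencil a b d₁ d₂ ρ) where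
  vanishes k := schemeCoeff_vanishes _ k
  moment m n k hm h := by
    rw [coeff_nodeMoment_uPoly _ m n (by omega)]
    cases k with
    | zero => simp [theStencil, schemeCoeff, pairing_nineLap hm (by omega : m + n ≤ 5)]
    | succ k =>
      unfold theStencil
      conv_lhs => enter [1, 1]; rw [schemeCoeff]
      refine (congrArg (· + _) (pairing_solveLevel (by omega) hm h _ ?_)).trans
        (neg_add_cancel _)
      -- The redundant equation, level one with `(m, n) = (1, 3)`. By `uPoly_of_le` the entries of
      -- order at most four are constant in `h`, so the linear coefficient sees order five only, and
      -- the nine-point Laplacian annihilates it.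
      intro hk hm hn
      obtain rfl : k = 0 := by omega
      subst hm hn
      rw [neg_eq_zero]
      refine Finset.sum_eq_zero fun i _ => ?_
      rw [show (i : ℕ) = 0 by omega, schemeCoeff]
      simp only [nodeCoeff, coeff_nodeTaylor]
      refine nineLap_realTaylor_eq_zero _ fun p q hpq => ?_
      obtain ⟨r, hr⟩ := (uPoly_of_le (a := a) (b := b) (d₁ := d₁) (d₂ := d₂) (ρ := ρ)
        1 3 p q (by omega)).1
      rw [hr, coeff_C]
      simp
  center := by simp [theStencil, schemeCoeff, nineLap]

/-! ### The right-hand side and the characterisation of the stencil -/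

lemma rhsSeries_eq (c : Stencil) (s : ℕ → ℕ → LH) : rhsSeries a b d₁ d₂ ρ c s =
    ∑ mn ∈ Lam3, s mn.1 mn.2 *
      toLaurent (X ^ (mn.1 + mn.2) * nodeMoment c (fPoly a b d₁ d₂ ρ mn.1 mn.2)) := by
  rw [rhsSeries, Finset.mul_sum]
  refine Finset.sum_congr rfl fun mn _ => ?_
  rw [momentJ_eq, pow_add _ _ 2, mul_assoc, mul_left_comm (X ^ _) (X ^ 2), map_mul _ (X ^ 2),
    toLaurent_X_pow, mul_left_comm, ← mul_assoc (LaurentPolynomial.T _) (LaurentPolynomial.T _),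
    ← LaurentPolynomial.T_add]
  simp

lemma mem_Lam3 {mn : ℕ × ℕ} : mn ∈ Lam3 ↔ mn.1 + mn.2 ≤ 3 := by
  simp only [Lam3, Finset.mem_filter, Finset.mem_product, Finset.mem_range]
  omega

lemma mem_Lam51 {mn : ℕ × ℕ} : mn ∈ Lam51 ↔ mn.1 ≤ 1 ∧ mn.1 + mn.2 ≤ 5 := by
  simp only [Lam51, Finset.mem_filter, Finset.mem_product, Finset.mem_range]
  omega

/-- At `h = 0` the jet with source `1` is the polynomial `r² / 2`, and its moment against the
nine-point Laplacian with centre `-10/3` is `1`. -/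
lemma coeff_zero_nodeMoment_fPoly :
    (nodeMoment (theStencil a b d₁ d₂ ρ) (fPoly a b d₁ d₂ ρ 0 0)).coeff 0 = 1 := by
  rw [coeff_nodeMoment _ _ (by omega)]
  simp only [zero_add, Finset.sum_range_one, tsub_self, coeff_nodeTaylor, fPoly,
    coeff_zero_elimRing, theStencil]
  simp [schemeCoeff, sum_offs, nineLap, realTaylor, Finset.sum_range_succ, flatJet_two,
    flatJet_three, flatJet_four, flatJet_five, apply_ite (fun P => coeff P 0), Nat.factorial]
  norm_num

/-- The terms with `(m, n) ≠ (0, 0)` carry `X ^ (m + n)` and do not reach degree zero. -/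
lemma leading_theStencil (f : ℕ → ℕ → ℝ) :
    (∀ k : ℤ, k < 0 → (rhsSeries a b d₁ d₂ ρ (theStencil a b d₁ d₂ ρ)
      (fun m n => const (f m n))).coeff k = 0) ∧
    (rhsSeries a b d₁ d₂ ρ (theStencil a b d₁ d₂ ρ) (fun m n => const (f m n))).coeff 0 =
      f 0 0 := by
  simp only [rhsSeries_eq, const_eq, ← map_mul, ← map_sum]
  refine ⟨fun k hk => coeff_toLaurent_of_neg _ hk, ?_⟩
  rw [← Nat.cast_zero, coeff_toLaurent_natCast, finsetSum_coeff,
    Finset.sum_eq_single (0, 0)]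
  · simp [coeff_zero_nodeMoment_fPoly]
  · rintro ⟨m, n⟩ - hmn
    rw [coeff_C_mul, mul_coeff_zero, coeff_X_pow, if_neg, zero_mul, mul_zero]
    simp only [ne_eq, Prod.mk.injEq] at hmn
    omega
  · intro h
    exact absurd (mem_Lam3.2 (by simp)) h

lemma isScheme_iff {c : Stencil} : IsScheme a b d₁ d₂ ρ c ↔ c = theStencil a b d₁ d₂ ρ := by
  constructor
  · intro h
    refine IsReduced.eq_theStencil ⟨fun k => ?_, fun m n k hm hk => ?_, h.center⟩
    · constructor
      · exact fun r l hrl => h.support r l k fun h' => hrl ⟨h'.1, h'.2.1⟩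
      all_goals
        intro hk
        rcases le_or_gt k 5 with h5 | h5
        · first
          | exact h.vanish_1_1 k hk h5
          | exact h.vanish_1_0 k hk h5
          | exact h.vanish_0_1 k hk h5
          | exact h.vanish_1_m1 k hk h5
          | exact h.vanish_m1_1 k hk h5
          | exact h.vanish_0_0 k hk h5
          | (obtain rfl : k = 5 := by omega
             first
             | exact h.vanish_m1_0
             | exact h.vanish_0_m1)
          | omega
        · exact h.support _ _ k fun h' => by omega
    · have := h.moment (m, n) (mem_Lam51.2 ⟨hm, by simp; omega⟩) ((k + (m + n) : ℕ) : ℤ)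
        (by omega)
      rw [momentI_eq, coeff_toLaurent_natCast, coeff_X_pow_mul] at this
      exact this
  · rintro rfl
    obtain ⟨hv, hm, hc⟩ := isReduced_theStencil (a := a) (b := b) (d₁ := d₁) (d₂ := d₂) (ρ := ρ)
    refine ⟨fun r l p h => ?_, fun mn hmn k hk => ?_, leading_theStencil,
      (hv 5).neg_zero le_rfl, fun p h _ => (hv p).neg_one h, (hv 5).zero_neg le_rfl,
      fun p h _ => (hv p).zero_zero h, fun p h _ => (hv p).zero_one h,
      fun p h _ => (hv p).one_neg h, fun p h _ => (hv p).one_zero h,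
      fun p h _ => (hv p).one_one h, hc⟩
    · by_cases hrl : r ∈ offs ∧ l ∈ offs
      · exact congrFun (congrFun ((hv p).eq_zero 
          (by by_contra h'; exact h ⟨hrl.1, hrl.2, by omega⟩)) r) l
      · exact (hv p).support r l hrl
    · rw [mem_Lam51] at hmn
      rw [momentI_eq]
      rcases lt_or_ge k 0 with h0 | h0
      · exact coeff_toLaurent_of_neg _ h0
      · lift k to ℕ using h0
        rw [coeff_toLaurent_natCast, coeff_X_pow_mul']
        split_ifs with h1
        · exact hm _ _ _ hmn.1 (by omega)
        · rfl

end Scheme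

/-! ### Uniform bounds -/

section Bounds

open Polynomial

variable {ι : Type*}

/-- A bounded family of real numbers. -/
def BddFam (f : ι → ℝ) : Prop := ∃ K, ∀ i, |f i| ≤ K

lemma BddFam.const (r : ℝ) : BddFam fun _ : ι => r := ⟨|r|, fun _ => le_rfl⟩

lemma BddFam.add {f g : ι → ℝ} (hf : BddFam f) (hg : BddFam g) : BddFam fun i => f i + g i := by
  obtain ⟨K, hK⟩ := hf
  obtain ⟨K', hK'⟩ := hg
  exact ⟨K + K', fun i => (abs_add_le _ _).trans (add_le_add (hK i) (hK' i))⟩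

lemma BddFam.neg {f : ι → ℝ} (hf : BddFam f) : BddFam fun i => -f i := by
  obtain ⟨K, hK⟩ := hf
  exact ⟨K, fun i => by rw [abs_neg]; exact hK i⟩

lemma BddFam.sub {f g : ι → ℝ} (hf : BddFam f) (hg : BddFam g) : BddFam fun i => f i - g i := by
  simpa only [sub_eq_add_neg] using hf.add hg.neg

lemma BddFam.mul {f g : ι → ℝ} (hf : BddFam f) (hg : BddFam g) : BddFam fun i => f i * g i := by
  obtain ⟨K, hK⟩ := hf
  obtain ⟨K', hK'⟩ := hg
  refine ⟨K * K', fun i => ?_⟩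
  rw [abs_mul]
  exact mul_le_mul (hK i) (hK' i) (abs_nonneg _) ((abs_nonneg _).trans (hK i))

lemma BddFam.sum {κ : Type*} {S : Finset κ} {f : κ → ι → ℝ} (hf : ∀ k ∈ S, BddFam (f k)) :
    BddFam fun i => ∑ k ∈ S, f k i := by
  classical
  induction S using Finset.induction_on with
  | empty => simpa using BddFam.const 0
  | insert k S hk ih =>
    simp only [Finset.sum_insert hk]
    exact (hf k (by simp)).add (ih fun k' hk' => hf k' (by simp [hk']))

/-- Families of polynomials with bounded degrees and coefficients. -/
def boundedPoly (ι : Type*) : Subring (ι → ℝ[X]) where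
  carrier := {F | ∃ D : ℕ, ∃ K : ℝ, ∀ i, (F i).natDegree ≤ D ∧ ∀ k, |(F i).coeff k| ≤ K}
  mul_mem' := by
    rintro F G ⟨D, K, hF⟩ ⟨D', K', hG⟩
    -- A coefficient of degree `k ≤ D + D'` is a sum of `k + 1` products, each at most `K * K'`;
    -- higher coefficients vanish.
    refine ⟨D + D', ((D + D' : ℕ) + 1) * (K * K'), fun i => ⟨?_, fun k => ?_⟩⟩
    · exact natDegree_mul_le.trans (add_le_add (hF i).1 (hG i).1)
    · have hK : 0 ≤ K := (abs_nonneg _).trans ((hF i).2 0)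
      have hK' : 0 ≤ K' := (abs_nonneg _).trans ((hG i).2 0)
      rcases le_or_gt k (D + D') with hk | hk
      · rw [Pi.mul_apply, coeff_mul]
        refine (Finset.abs_sum_le_sum_abs _ _).trans ?_
        refine (Finset.sum_le_card_nsmul _ _ (K * K') fun x _ => ?_).trans ?_
        · rw [abs_mul]
          exact mul_le_mul ((hF i).2 _) ((hG i).2 _) (abs_nonneg _) hK
        · rw [Finset.Nat.card_antidiagonal, nsmul_eq_mul]
          have : ((k + 1 : ℕ) : ℝ) ≤ (D + D' : ℕ) + 1 := by exact_mod_cast Nat.succ_le_succ hk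
          gcongr
      · rw [Pi.mul_apply, coeff_eq_zero_of_natDegree_lt, abs_zero]
        · positivity
        · exact (natDegree_mul_le.trans (add_le_add (hF i).1 (hG i).1)).trans_lt hk
  one_mem' := ⟨0, 1, fun i => ⟨by simp, fun k => by
    rw [Pi.one_apply, coeff_one]; split_ifs <;> simp⟩⟩
  add_mem' := by
    rintro F G ⟨D, K, hF⟩ ⟨D', K', hG⟩
    refine ⟨max D D', K + K', fun i => ⟨?_, fun k => ?_⟩⟩
    · exact (natDegree_add_le _ _).trans (max_le_max (hF i).1 (hG i).1)
    · rw [Pi.add_apply, coeff_add]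
      exact (abs_add_le _ _).trans (add_le_add ((hF i).2 k) ((hG i).2 k))
  zero_mem' := ⟨0, 0, fun i => by simp⟩
  neg_mem' := by
    rintro F ⟨D, K, hF⟩
    exact ⟨D, K, fun i => by simpa using hF i⟩

lemma C_mem_boundedPoly {f : ι → ℝ} (hf : BddFam f) : (fun i => C (f i)) ∈ boundedPoly ι := by
  obtain ⟨K, hK⟩ := hf
  refine ⟨0, max K 0, fun i => ⟨by simp, fun k => ?_⟩⟩
  rw [coeff_C]
  split_ifs
  · exact (hK i).trans (le_max_left _ _)
  · simp

lemma X_mem_boundedPoly : (fun _ => X : ι → ℝ[X]) ∈ boundedPoly ι :=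
  ⟨1, 1, fun i => ⟨natDegree_X_le, fun k => by rw [coeff_X]; split_ifs <;> simp⟩⟩

lemma X_pow_mem_boundedPoly (n : ℕ) : (fun _ => X ^ n : ι → ℝ[X]) ∈ boundedPoly ι :=
  pow_mem X_mem_boundedPoly n

lemma sum_mem_boundedPoly {κ : Type*} {S : Finset κ} {F : κ → ι → ℝ[X]}
    (hF : ∀ k ∈ S, F k ∈ boundedPoly ι) : (fun i => ∑ k ∈ S, F k i) ∈ boundedPoly ι := by
  have := sum_mem hF
  rwa [show ∑ k ∈ S, F k = fun i => ∑ k ∈ S, F k i by ext; simp] at this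

lemma bddFam_coeff {F : ι → ℝ[X]} (hF : F ∈ boundedPoly ι) (k : ℕ) :
    BddFam fun i => (F i).coeff k := by
  obtain ⟨D, K, h⟩ := hF
  exact ⟨K, fun i => (h i).2 k⟩

/-- Uniform bound for the terms of degree at least `n`. -/
lemma abs_eval_sub_le {F : ι → ℝ[X]} (hF : F ∈ boundedPoly ι) (n : ℕ) (L : ℝ) :
    ∃ K, ∀ i, ∀ h : ℝ, 0 ≤ h → h ≤ L →
      |(F i).eval h - ∑ k ∈ Finset.range n, (F i).coeff k * h ^ k| ≤ K * h ^ n := by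
  obtain ⟨D, K, hF⟩ := hF
  refine ⟨∑ j ∈ Finset.range (D + 1), K * L ^ j, fun i h h0 hL => ?_⟩
  have hK : 0 ≤ K := (abs_nonneg _).trans ((hF i).2 0)
  -- Padding the sum to length `n + (D + 1)` makes the first `n` terms cancel exactly.
  rw [eval_eq_sum_range' (n := n + (D + 1)) (by have := (hF i).1; omega), Finset.sum_range_add,
    add_sub_cancel_left, Finset.sum_mul]
  refine (Finset.abs_sum_le_sum_abs _ _).trans (Finset.sum_le_sum fun j _ => ?_)
  rw [abs_mul, pow_add, abs_of_nonneg (by positivity : 0 ≤ h ^ n * h ^ j), mul_comm (h ^ n),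
    ← mul_assoc]
  have := (hF i).2 (n + j)
  gcongr

variable {a b d₁ d₂ : ι → ℕ → ℕ → ℝ} (ρ : ℝ)

lemma scaledFirst_mem_boundedPoly {k l : ℕ} (ha : BddFam fun i => a i k l) :
    (fun i => scaledFirst (a i) k l) ∈ boundedPoly ι :=
  (boundedPoly ι).mul_mem (X_pow_mem_boundedPoly (k + l + 1)) (C_mem_boundedPoly ha)

lemma scaledReaction_mem_boundedPoly {k l : ℕ} (hd₁ : BddFam fun i => d₁ i k l)
    (hd₂ : BddFam fun i => d₂ i k l) :
    (fun i => scaledReaction (d₁ i) (d₂ i) ρ k l) ∈ boundedPoly ι := by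
  have h : BddFam fun i => d₁ i k l / ρ := by
    simpa only [div_eq_mul_inv] using hd₁.mul (.const ρ⁻¹)
  exact (boundedPoly ι).add_mem
    ((boundedPoly ι).mul_mem (X_pow_mem_boundedPoly (k + l + 1)) (C_mem_boundedPoly h))
    ((boundedPoly ι).mul_mem (X_pow_mem_boundedPoly (k + l + 2)) (C_mem_boundedPoly hd₂))

/-- The recursion is run once in the ring `ι → ℝ[X]`, where evaluation at an index is a ring
homomorphism; uniformity in the index is then membership in a subring. -/
lemma elimRing_mem_boundedPoly (ha : ∀ p q, BddFam fun i => a i p q)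
    (hb : ∀ p q, BddFam fun i => b i p q) (hd₁ : ∀ p q, BddFam fun i => d₁ i p q)
    (hd₂ : ∀ p q, BddFam fun i => d₂ i p q) {g₀ g₁ : ℕ → ℝ[X]} {s : ℕ → ℕ → ℝ[X]}
    (h0 : ∀ q, (fun _ => g₀ q) ∈ boundedPoly ι) (h1 : ∀ q, (fun _ => g₁ q) ∈ boundedPoly ι)
    (hs : ∀ p q, (fun _ => s p q) ∈ boundedPoly ι) (p q : ℕ) :
    (fun i => elimRing (scaledFirst (a i)) (scaledFirst (b i))
      (scaledReaction (d₁ i) (d₂ i) ρ) g₀ g₁ s p q) ∈ boundedPoly ι := by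
  have key := elimRing_mem (a := fun k l i => scaledFirst (a i) k l)
    (b := fun k l i => scaledFirst (b i) k l)
    (d := fun k l i => scaledReaction (d₁ i) (d₂ i) ρ k l) (g₀ := fun q _ => g₀ q)
    (g₁ := fun q _ => g₁ q) (s := fun p q _ => s p q) (boundedPoly ι)
    (fun k l => scaledFirst_mem_boundedPoly (ha k l))
    (fun k l => scaledFirst_mem_boundedPoly (hb k l))
    (fun k l => scaledReaction_mem_boundedPoly ρ (hd₁ k l) (hd₂ k l)) hs h0 h1 p q
  convert key using 1
  funext i
  exact (map_elimRing (a := fun k l i => scaledFirst (a i) k l)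
    (b := fun k l i => scaledFirst (b i) k l)
    (d := fun k l i => scaledReaction (d₁ i) (d₂ i) ρ k l) (g₀ := fun q _ => g₀ q)
    (g₁ := fun q _ => g₁ q) (s := fun p q _ => s p q)
    (Pi.evalRingHom (fun _ => ℝ[X]) i) p q).symm

lemma const_ite_mem_boundedPoly (c : Prop) [Decidable c] :
    (fun _ => if c then 1 else 0 : ι → ℝ[X]) ∈ boundedPoly ι := by
  split_ifs
  · exact one_mem _
  · exact zero_mem _

lemma nodeTaylor_mem_boundedPoly {w : ι → ℕ → ℕ → ℝ[X]}
    (hw : ∀ p q, (fun i => w i p q) ∈ boundedPoly ι) (r l : ℤ) :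
    (fun i => nodeTaylor (w i) r l) ∈ boundedPoly ι :=
  sum_mem_boundedPoly fun p _ => sum_mem_boundedPoly fun q _ =>
    (boundedPoly ι).mul_mem (C_mem_boundedPoly (.const _)) (hw p q)

lemma nodeMoment_mem_boundedPoly {c : ι → Stencil} (hc : ∀ r l k, BddFam fun i => c i r l k)
    {w : ι → ℕ → ℕ → ℝ[X]} (hw : ∀ p q, (fun i => w i p q) ∈ boundedPoly ι) :
    (fun i => nodeMoment (c i) (w i)) ∈ boundedPoly ι := by
  have h : ∀ r l, (fun i => stencilPolynomial (c i) r l) ∈ boundedPoly ι := fun r l =>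
    sum_mem_boundedPoly fun p _ =>
      (boundedPoly ι).mul_mem (C_mem_boundedPoly (hc r l p)) (X_pow_mem_boundedPoly p)
  exact sum_mem_boundedPoly fun r _ => sum_mem_boundedPoly fun l _ =>
    (boundedPoly ι).mul_mem (h r l) (nodeTaylor_mem_boundedPoly hw r l)

lemma bddFam_nodeVec {A B C D E F G H I : ι → ℝ} (hA : BddFam A) (hB : BddFam B) (hC : BddFam C)
    (hD : BddFam D) (hE : BddFam E) (hF : BddFam F) (hG : BddFam G) (hH : BddFam H)
    (hI : BddFam I) (r l : ℤ) :
    BddFam fun i => nodeVec (A i) (B i) (C i) (D i) (E i) (F i) (G i) (H i) (I i) r l := by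
  unfold nodeVec
  split_ifs <;> first | assumption | exact .const 0

lemma bddFam_solveLevel {R : ι → ℕ → ℕ → ℝ} (hR : ∀ m n, BddFam fun i => R i m n) (k : ℕ)
    (r l : ℤ) : BddFam fun i => solveLevel k (R i) r l := by
  match k with
  | 0 => exact .const 0
  | 1 | 2 | 3 | 4 | 5 =>
    unfold solveLevel
    apply bddFam_nodeVec
    all_goals
      repeat' first
        | exact .const _
        | exact hR _ _
        | apply BddFam.add
        | apply BddFam.sub
        | apply BddFam.neg
        | apply BddFam.mul
  | k + 6 => exact .const 0

lemma bddFam_schemeCoeff {Γ : ι → ℕ → ℕ → ℤ → ℤ → ℕ → ℝ}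
    (hΓ : ∀ m n r l k, BddFam fun i => Γ i m n r l k) (k : ℕ) :
    ∀ r l, BddFam fun i => schemeCoeff (Γ i) k r l := by
  induction k using Nat.strong_induction_on with
  | _ k ih =>
    intro r l
    cases k with
    | zero => simp only [schemeCoeff]; exact .const _
    | succ k =>
      simp only [schemeCoeff]
      refine bddFam_solveLevel (fun m n => ?_) _ _ _
      exact .neg (.sum fun j _ => .sum fun r _ => .sum fun l _ =>
        (ih (j : Fin (k + 1)) j.2 r l).mul (hΓ _ _ _ _ _))

lemma uPoly_mem_boundedPoly (ha : ∀ p q, BddFam fun i => a i p q)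
    (hb : ∀ p q, BddFam fun i => b i p q) (hd₁ : ∀ p q, BddFam fun i => d₁ i p q)
    (hd₂ : ∀ p q, BddFam fun i => d₂ i p q) (m n p q : ℕ) :
    (fun i => uPoly (a i) (b i) (d₁ i) (d₂ i) ρ m n p q) ∈ boundedPoly ι :=
  elimRing_mem_boundedPoly ρ ha hb hd₁ hd₂ (fun _ => const_ite_mem_boundedPoly _)
    (fun _ => const_ite_mem_boundedPoly _) (fun _ _ => zero_mem _) p q

lemma fPoly_mem_boundedPoly (ha : ∀ p q, BddFam fun i => a i p q)
    (hb : ∀ p q, BddFam fun i => b i p q) (hd₁ : ∀ p q, BddFam fun i => d₁ i p q)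
    (hd₂ : ∀ p q, BddFam fun i => d₂ i p q) (m n p q : ℕ) :
    (fun i => fPoly (a i) (b i) (d₁ i) (d₂ i) ρ m n p q) ∈ boundedPoly ι :=
  elimRing_mem_boundedPoly ρ ha hb hd₁ hd₂ (fun _ => zero_mem _) (fun _ => zero_mem _)
    (fun _ _ => const_ite_mem_boundedPoly _) p q

lemma bddFam_theStencil (ha : ∀ p q, BddFam fun i => a i p q)
    (hb : ∀ p q, BddFam fun i => b i p q) (hd₁ : ∀ p q, BddFam fun i => d₁ i p q)
    (hd₂ : ∀ p q, BddFam fun i => d₂ i p q) (r l : ℤ) (k : ℕ) :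
    BddFam fun i => theStencil (a i) (b i) (d₁ i) (d₂ i) ρ r l k :=
  bddFam_schemeCoeff (fun m n r l k => bddFam_coeff (nodeTaylor_mem_boundedPoly
    (uPoly_mem_boundedPoly ρ ha hb hd₁ hd₂ m n) r l) k) k r l

end Bounds

/-! ### Truncation error of the Taylor polynomial -/

section Truncation

open Polynomial

/-- The stencil at mesh size `h`, applied to scaled real derivatives `W`. -/
def evalMoment (c : Stencil) (h : ℝ) (W : ℕ → ℕ → ℝ) : ℝ :=
  ∑ r ∈ offs, ∑ l ∈ offs, (∑ p ∈ Finset.range 6, c r l p * h ^ p) * realTaylor W r l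

lemma eval_nodeMoment (c : Stencil) (h : ℝ) (w : ℕ → ℕ → ℝ[X]) :
    (nodeMoment c w).eval h = evalMoment c h fun p q => (w p q).eval h := by
  simp [nodeMoment, evalMoment, eval_finsetSum, stencilPolynomial, nodeTaylor, realTaylor]

lemma realTaylor_congr {W W' : ℕ → ℕ → ℝ} (h : ∀ p q, p + q ≤ 5 → W p q = W' p q) (r l : ℤ) :
    realTaylor W r l = realTaylor W' r l := by
  refine Finset.sum_congr rfl fun p hp => Finset.sum_congr rfl fun q hq => ?_
  rw [Finset.mem_range] at hp hq
  rw [h p q (by omega)]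

lemma evalMoment_congr (c : Stencil) (h : ℝ) {W W' : ℕ → ℕ → ℝ}
    (hW : ∀ p q, p + q ≤ 5 → W p q = W' p q) : evalMoment c h W = evalMoment c h W' := by
  simp only [evalMoment, realTaylor_congr hW]

lemma evalMoment_add (c : Stencil) (h : ℝ) (W W' : ℕ → ℕ → ℝ) :
    evalMoment c h (fun p q => W p q + W' p q) = evalMoment c h W + evalMoment c h W' := by
  simp only [evalMoment, realTaylor, mul_add, Finset.sum_add_distrib]

lemma evalMoment_sum {κ : Type*} (S : Finset κ) (c : Stencil) (h : ℝ) (e : κ → ℝ)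
    (W : κ → ℕ → ℕ → ℝ) : evalMoment c h (fun p q => ∑ k ∈ S, e k * W k p q) =
      ∑ k ∈ S, e k * evalMoment c h (W k) := by
  classical
  induction S using Finset.induction_on with
  | empty => simp [evalMoment, realTaylor]
  | insert k S hk ih =>
    simp only [Finset.sum_insert hk, evalMoment_add, ih]
    congr 1
    simp only [evalMoment, realTaylor, Finset.mul_sum]
    refine Finset.sum_congr rfl fun _ _ => Finset.sum_congr rfl fun _ _ =>
      Finset.sum_congr rfl fun _ _ => Finset.sum_congr rfl fun _ _ => ?_
    rw [mul_left_comm (e k), mul_left_comm (e k)]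

variable {a b d₁ d₂ f U : ℕ → ℕ → ℝ} {ρ h : ℝ}

lemma eval_scaledFirst (i j : ℕ) :
    evalRingHom h (scaledFirst a i j) = h ^ (i + j + 1) * a i j := by
  simp only [scaledFirst, coe_evalRingHom, eval_mul, eval_pow, eval_X, eval_C]

lemma eval_scaledReaction (hh : h ≠ 0) (i j : ℕ) : evalRingHom h (scaledReaction d₁ d₂ ρ i j) =
    h ^ (i + j + 2) * (d₁ i j / (ρ * h) + d₂ i j) := by
  simp only [scaledReaction, coe_evalRingHom, eval_add, eval_mul, eval_pow, eval_X, eval_C]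
  rw [div_mul_eq_div_div, pow_succ h (i + j + 1)]
  field_simp

/-- The derivatives up to order five in terms of the free ones. -/
lemma scaled_jet_eq (hh : h ≠ 0) (hU : IsJet 5 a b (fun i j => d₁ i j / (ρ * h) + d₂ i j) f U)
    (p q : ℕ) (hpq : p + q ≤ 5) :
    h ^ (p + q) * U p q =
      ∑ mn ∈ Lam51, (U mn.1 mn.2 * h ^ (mn.1 + mn.2)) *
          (uPoly a b d₁ d₂ ρ mn.1 mn.2 p q).eval h +
        ∑ mn ∈ Lam3, (f mn.1 mn.2 * h ^ (mn.1 + mn.2 + 2)) *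
          (fPoly a b d₁ d₂ ρ mn.1 mn.2 p q).eval h := by
  have h1 := hU.scale h
  simp only [← eval_scaledFirst, ← eval_scaledReaction hh] at h1
  -- The superposition of elementary jets has the same source and free entries as the scaled jet of
  -- `U`, so the two agree up to order five.
  have h2 : IsJet 5 (fun i j => evalRingHom h (scaledFirst a i j))
      (fun i j => evalRingHom h (scaledFirst b i j))
      (fun i j => evalRingHom h (scaledReaction d₁ d₂ ρ i j)) _ _ :=
    (IsJet.sum (S := Lam51) fun mn _ => (isJet_elimRing.map (evalRingHom h)).const_mul
      (w := fun i j => evalRingHom h (uPoly a b d₁ d₂ ρ mn.1 mn.2 i j))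
      (U mn.1 mn.2 * h ^ (mn.1 + mn.2))).add
    (IsJet.sum (S := Lam3) fun mn _ => (isJet_elimRing.map (evalRingHom h)).const_mul
      (w := fun i j => evalRingHom h (fPoly a b d₁ d₂ ρ mn.1 mn.2 i j))
      (f mn.1 mn.2 * h ^ (mn.1 + mn.2 + 2)))
  refine h1.unique h2 (fun p q hpq => ?_) (fun q hq => ?_) (fun q hq => ?_) p q hpq
  · simp only [map_zero, mul_zero, Finset.sum_const_zero, zero_add]
    rw [Finset.sum_eq_single (p, q)]
    · simp [mul_comm]
    · rintro ⟨m, n⟩ - hmn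
      rw [if_neg (fun h => hmn (by simpa [eq_comm] using h)), map_zero, mul_zero]
    · intro h
      exact absurd (mem_Lam3.2 (by simp; omega)) h
  · simp only [uPoly, fPoly, elimRing_zero, map_zero, mul_zero, Finset.sum_const_zero, add_zero]
    rw [Finset.sum_eq_single (0, q)]
    · simp [mul_comm]
    · rintro ⟨m, n⟩ - hmn
      rw [if_neg (fun h => hmn (by simpa [eq_comm] using h)), map_zero, mul_zero]
    · intro h
      exact absurd (mem_Lam51.2 (by simp; omega)) h
  · simp only [uPoly, fPoly, elimRing_one, map_zero, mul_zero, Finset.sum_const_zero, add_zero]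
    rw [Finset.sum_eq_single (1, q)]
    · simp [mul_comm]
    · rintro ⟨m, n⟩ - hmn
      rw [if_neg (fun h => hmn (by simpa [eq_comm] using h)), map_zero, mul_zero]
    · intro h
      exact absurd (mem_Lam51.2 (by simp; omega)) h

lemma evalMoment_scaled_jet (c : Stencil) (hh : h ≠ 0)
    (hU : IsJet 5 a b (fun i j => d₁ i j / (ρ * h) + d₂ i j) f U) :
    evalMoment c h (fun p q => h ^ (p + q) * U p q) =
      ∑ mn ∈ Lam51, U mn.1 mn.2 *
          (X ^ (mn.1 + mn.2) * nodeMoment c (uPoly a b d₁ d₂ ρ mn.1 mn.2)).eval h +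
        ∑ mn ∈ Lam3, (f mn.1 mn.2 * h ^ (mn.1 + mn.2 + 2)) *
          (nodeMoment c (fPoly a b d₁ d₂ ρ mn.1 mn.2)).eval h := by
  rw [evalMoment_congr c h (scaled_jet_eq hh hU), evalMoment_add, evalMoment_sum, evalMoment_sum]
  simp only [eval_mul, eval_pow, eval_X, eval_nodeMoment, mul_assoc]

/-- The polynomial `h⁻¹ ∑ (h f₁ + f₂ / ρ) J`. -/
def rhsPoly (a b d₁ d₂ : ℕ → ℕ → ℝ) (ρ : ℝ) (c : Stencil) (f₁ f₂ : ℕ → ℕ → ℝ) : ℝ[X] :=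
  ∑ mn ∈ Lam3, (C (f₁ mn.1 mn.2) * X + C (f₂ mn.1 mn.2 / ρ)) *
    (X ^ (mn.1 + mn.2) * nodeMoment c (fPoly a b d₁ d₂ ρ mn.1 mn.2))

lemma evalUpToThree_eq_sum (P : LH) (h : ℝ) :
    evalUpToThree P h = P.coeff.sum fun k v => if k ≤ 3 then v * h ^ k else 0 := by
  rw [evalUpToThree, Finset.sum_filter, Finsupp.sum]

lemma evalUpToThree_add (P Q : LH) (h : ℝ) :
    evalUpToThree (P + Q) h = evalUpToThree P h + evalUpToThree Q h := by
  simp only [evalUpToThree_eq_sum, AddMonoidAlgebra.coeff_add]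
  refine Finsupp.sum_add_index' (fun k => by simp) fun k v v' => ?_
  split_ifs <;> ring

/-- The factor `h⁻¹` lowers degrees by one, so degree at most three means the first five
coefficients of `Q`. By linearity monomials suffice. -/
lemma evalUpToThree_T_neg_one_mul (Q : ℝ[X]) (hh : h ≠ 0) :
    evalUpToThree (LaurentPolynomial.T (-1) * toLaurent Q) h =
      h⁻¹ * ∑ k ∈ Finset.range 5, Q.coeff k * h ^ k := by
  induction Q using Polynomial.induction_on' with
  | add p q hp hq =>
    simp only [map_add, mul_add, evalUpToThree_add, hp, hq, coeff_add, add_mul,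
      Finset.sum_add_distrib]
  | monomial n r =>
    have : LaurentPolynomial.T (-1) * toLaurent (monomial n r) =
        AddMonoidAlgebra.single ((n : ℤ) - 1) r := by
      rw [toLaurent_C_mul_T, LaurentPolynomial.single_eq_C_mul_T, mul_left_comm,
        ← LaurentPolynomial.T_add, neg_add_eq_sub]
    rw [this, evalUpToThree_eq_sum, AddMonoidAlgebra.coeff_single,
      Finsupp.sum_single_index (by simp)]
    simp only [coeff_monomial, ite_mul, zero_mul, Finset.sum_ite_eq, Finset.mem_range]
    by_cases hn : n < 5
    · rw [if_pos (by omega), if_pos hn, zpow_sub_one₀ hh, zpow_natCast]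
      ring
    · rw [if_neg (by omega), if_neg hn, mul_zero]

lemma source_mul_toLaurent (x y : ℝ) (P : ℝ[X]) :
    (const x + const y * LaurentPolynomial.T (-1)) * toLaurent P =
      LaurentPolynomial.T (-1) * toLaurent ((C x * X + C y) * P) := by
  have h : (LaurentPolynomial.T (-1) : LH) * LaurentPolynomial.T 1 = 1 := by
    rw [← LaurentPolynomial.T_add, neg_add_cancel, LaurentPolynomial.T_zero]
  rw [map_mul, map_add, map_mul, ← const_eq, ← const_eq, toLaurent_X]
  linear_combination (-const x * toLaurent P) * h

lemma rhsF_eq (c : Stencil) (f₁ f₂ : ℕ → ℕ → ℝ) (hh : h ≠ 0) :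
    rhsF a b d₁ d₂ ρ c f₁ f₂ h =
      h⁻¹ * ∑ k ∈ Finset.range 5, (rhsPoly a b d₁ d₂ ρ c f₁ f₂).coeff k * h ^ k := by
  rw [← evalUpToThree_T_neg_one_mul _ hh, rhsF, rhsSeries_eq]
  simp only [source_mul_toLaurent]
  rw [← Finset.mul_sum, ← map_sum, rhsPoly]

/-- This is the untruncated right-hand side; it differs from `rhsF` by the tail of `rhsPoly` from
degree five on. -/
lemma eval_rhsPoly (c : Stencil) (f₁ f₂ : ℕ → ℕ → ℝ) (hρ : ρ ≠ 0) (hh : h ≠ 0) :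
    (h ^ 2)⁻¹ * ∑ mn ∈ Lam3, ((f₁ mn.1 mn.2 + f₂ mn.1 mn.2 / (ρ * h)) * h ^ (mn.1 + mn.2 + 2)) *
      (nodeMoment c (fPoly a b d₁ d₂ ρ mn.1 mn.2)).eval h =
    h⁻¹ * (rhsPoly a b d₁ d₂ ρ c f₁ f₂).eval h := by
  rw [rhsPoly, eval_finsetSum, Finset.mul_sum, Finset.mul_sum]
  refine Finset.sum_congr rfl fun mn _ => ?_
  simp only [eval_add, eval_mul, eval_C, eval_X, eval_pow]
  rw [pow_add]
  field_simp

end Truncation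

/-! ### Uniform fourth order consistency for Taylor jets -/

section Consistency

open Polynomial

variable {ι : Type*} {a b d₁ d₂ f₁ f₂ U : ι → ℕ → ℕ → ℝ} {ρ L : ℝ} {h : ι → ℝ}

/-- Fourth order consistency on Taylor polynomials, uniformly over a family of bounded data. -/
theorem taylor_consistency (hρ : ρ ≠ 0) (ha : ∀ p q, BddFam fun i => a i p q)
    (hb : ∀ p q, BddFam fun i => b i p q) (hd₁ : ∀ p q, BddFam fun i => d₁ i p q)
    (hd₂ : ∀ p q, BddFam fun i => d₂ i p q)
    (hf₁ : ∀ p q, p + q ≤ 3 → BddFam fun i => f₁ i p q)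
    (hf₂ : ∀ p q, p + q ≤ 3 → BddFam fun i => f₂ i p q)
    (hU : ∀ p q, p + q ≤ 5 → BddFam fun i => U i p q) (h0 : ∀ i, 0 < h i) (hL : ∀ i, h i ≤ L)
    (hjet : ∀ i, IsJet 5 (a i) (b i) (fun p q => d₁ i p q / (ρ * h i) + d₂ i p q)
      (fun p q => f₁ i p q + f₂ i p q / (ρ * h i)) (U i)) :
    ∃ K, ∀ i, |(h i ^ 2)⁻¹ * evalMoment (theStencil (a i) (b i) (d₁ i) (d₂ i) ρ) (h i)
        (fun p q => h i ^ (p + q) * U i p q) -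
      rhsF (a i) (b i) (d₁ i) (d₂ i) ρ (theStencil (a i) (b i) (d₁ i) (d₂ i) ρ) (f₁ i) (f₂ i)
        (h i)| ≤ K * h i ^ 4 := by
  set c : ι → Stencil := fun i => theStencil (a i) (b i) (d₁ i) (d₂ i) ρ with hc
  have hcb : ∀ r l k, BddFam fun i => c i r l k := bddFam_theStencil ρ ha hb hd₁ hd₂
  have hR : (fun i => rhsPoly (a i) (b i) (d₁ i) (d₂ i) ρ (c i) (f₁ i) (f₂ i)) ∈
      boundedPoly ι := by
    refine sum_mem_boundedPoly fun mn hmn => ?_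
    rw [mem_Lam3] at hmn
    have h2 : BddFam fun i => f₂ i mn.1 mn.2 / ρ := by
      simpa only [div_eq_mul_inv] using (hf₂ _ _ hmn).mul (.const ρ⁻¹)
    have h3 := (boundedPoly ι).add_mem ((boundedPoly ι).mul_mem
      (C_mem_boundedPoly (hf₁ _ _ hmn)) X_mem_boundedPoly) (C_mem_boundedPoly h2)
    exact (boundedPoly ι).mul_mem h3 ((boundedPoly ι).mul_mem
      (X_pow_mem_boundedPoly (mn.1 + mn.2)) (nodeMoment_mem_boundedPoly hcb
        (fPoly_mem_boundedPoly ρ ha hb hd₁ hd₂ mn.1 mn.2)))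
  -- The tail starts at `h^5`; the factor `h⁻¹` in `rhsF_eq` brings it to `h^4`.
  obtain ⟨KR, hKR⟩ := abs_eval_sub_le hR 5 L
  have hI : ∀ mn ∈ Lam51, ∃ K, 0 ≤ K ∧ ∀ i, |U i mn.1 mn.2 * (X ^ (mn.1 + mn.2) *
      nodeMoment (c i) (uPoly (a i) (b i) (d₁ i) (d₂ i) ρ mn.1 mn.2)).eval (h i)| ≤
        K * h i ^ 6 := by
    intro mn hmn
    rw [mem_Lam51] at hmn
    obtain ⟨K, hK⟩ := abs_eval_sub_le (mul_mem (X_pow_mem_boundedPoly (mn.1 + mn.2))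
      (nodeMoment_mem_boundedPoly hcb (uPoly_mem_boundedPoly ρ ha hb hd₁ hd₂ mn.1 mn.2))) 6 L
    obtain ⟨M, hM⟩ := hU _ _ hmn.2
    refine ⟨|M| * |K|, by positivity, fun i => ?_⟩
    have h1 := hK i (h i) (h0 i).le (hL i)
    -- The moment conditions remove every coefficient of degree below six.
    rw [Finset.sum_eq_zero, sub_zero] at h1
    · rw [abs_mul, mul_assoc]
      have h2 := h0 i
      refine mul_le_mul ((hM i).trans (le_abs_self M)) (h1.trans ?_) (abs_nonneg _) (abs_nonneg _)
      gcongr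
      exact le_abs_self K
    · intro k hk
      rw [Finset.mem_range] at hk
      rw [Pi.mul_apply, coeff_X_pow_mul']
      split_ifs with h3
      · rw [hc, isReduced_theStencil.moment _ _ _ hmn.1 (by omega), zero_mul]
      · rw [zero_mul]
  choose! KI hKI0 hKI using hI
  refine ⟨∑ mn ∈ Lam51, KI mn + KR, fun i => ?_⟩
  have hh := h0 i
  rw [evalMoment_scaled_jet _ hh.ne' (hjet i), mul_add, eval_rhsPoly _ _ _ hρ hh.ne',
    rhsF_eq _ _ _ hh.ne', add_sub_assoc, ← mul_sub, add_mul]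
  refine (abs_add_le _ _).trans (add_le_add ?_ ?_)
  · rw [abs_mul, abs_of_pos (by positivity), inv_mul_le_iff₀ (by positivity)]
    refine (Finset.abs_sum_le_sum_abs _ _).trans
      ((Finset.sum_le_sum fun mn hmn => hKI mn hmn i).trans (le_of_eq ?_))
    rw [← Finset.sum_mul]
    ring
  · rw [abs_mul, abs_of_pos (by positivity), inv_mul_le_iff₀ hh]
    exact (hKR i (h i) hh.le (hL i)).trans (le_of_eq (by ring))

end Consistency

/-! ### Partial derivatives of smooth functions on open sets -/

section PartialDerivatives

open Filter Topology

/-- `v` is smooth on `U ⊆ ℝ²`. -/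
def SmoothOn (U : Set (ℝ × ℝ)) (v : ℝ → ℝ → ℝ) : Prop :=
  ContDiffOn ℝ ∞ (fun p : ℝ × ℝ => v p.1 p.2) U

variable {U : Set (ℝ × ℝ)} {v w : ℝ → ℝ → ℝ} {x y : ℝ}

lemma SmoothOn.contDiffAt (hv : SmoothOn U v) (hU : IsOpen U) (hp : (x, y) ∈ U) :
    ContDiffAt ℝ ∞ (fun p : ℝ × ℝ => v p.1 p.2) (x, y) :=
  ContDiffOn.contDiffAt hv (hU.mem_nhds hp)

lemma SmoothOn.hasFDerivAt (hv : SmoothOn U v) (hU : IsOpen U) (hp : (x, y) ∈ U) :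
    HasFDerivAt (fun p : ℝ × ℝ => v p.1 p.2)
      (fderiv ℝ (fun p : ℝ × ℝ => v p.1 p.2) (x, y)) (x, y) :=
  ((hv.contDiffAt hU hp).differentiableAt (by simp)).hasFDerivAt

lemma hasDerivAt_slice_fst {F : ℝ × ℝ → ℝ} {F' : ℝ × ℝ →L[ℝ] ℝ} (hF : HasFDerivAt F F' (x, y)) :
    HasDerivAt (fun s => F (s, y)) (F' (1, 0)) x :=
  hF.comp_hasDerivAt x ((hasDerivAt_id x).prodMk (hasDerivAt_const x y))

lemma hasDerivAt_slice_snd {F : ℝ × ℝ → ℝ} {F' : ℝ × ℝ →L[ℝ] ℝ} (hF : HasFDerivAt F F' (x, y)) :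
    HasDerivAt (fun z => F (x, z)) (F' (0, 1)) y :=
  hF.comp_hasDerivAt y ((hasDerivAt_const y x).prodMk (hasDerivAt_id y))

lemma pd_succ_left (m n : ℕ) (v : ℝ → ℝ → ℝ) (x y : ℝ) :
    pd (m + 1) n v x y = deriv (fun s => pd m n v s y) x := by
  rw [pd, iteratedDeriv_succ]
  rfl

lemma pd_zero_left (n : ℕ) (v : ℝ → ℝ → ℝ) (x y : ℝ) :
    pd 0 n v x y = iteratedDeriv n (fun z => v x z) y := by
  rw [pd, iteratedDeriv_zero]

lemma pd_zero_succ (n : ℕ) (v : ℝ → ℝ → ℝ) (x y : ℝ) :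
    pd 0 (n + 1) v x y = deriv (fun z => pd 0 n v x z) y := by
  simp only [pd_zero_left, iteratedDeriv_succ]

@[simp] lemma pd_zero_zero (v : ℝ → ℝ → ℝ) (x y : ℝ) : pd 0 0 v x y = v x y := by
  simp [pd]

lemma eventually_slice_fst (hU : IsOpen U) (hp : (x, y) ∈ U) : ∀ᶠ s in 𝓝 x, (s, y) ∈ U :=
  (Continuous.prodMk_left y).continuousAt.eventually_mem (hU.mem_nhds hp)

lemma eventually_slice_snd (hU : IsOpen U) (hp : (x, y) ∈ U) : ∀ᶠ z in 𝓝 y, (x, z) ∈ U :=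
  (Continuous.prodMk_right x).continuousAt.eventually_mem (hU.mem_nhds hp)

lemma pd_congr (hU : IsOpen U) (h : ∀ x y, (x, y) ∈ U → v x y = w x y) (m n : ℕ)
    (hp : (x, y) ∈ U) : pd m n v x y = pd m n w x y := by
  rw [pd, pd]
  refine EventuallyEq.eq_of_nhds (EventuallyEq.iteratedDeriv ?_ m)
  filter_upwards [eventually_slice_fst hU hp] with s hs
  refine EventuallyEq.eq_of_nhds (EventuallyEq.iteratedDeriv ?_ n)
  filter_upwards [eventually_slice_snd hU hs] with z hz
  exact h s z hz

lemma SmoothOn.congr (hv : SmoothOn U v) (h : ∀ x y, (x, y) ∈ U → w x y = v x y) :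
    SmoothOn U w :=
  ContDiffOn.congr hv fun p hp => h p.1 p.2 hp

lemma SmoothOn.fderiv_apply (hv : SmoothOn U v) (hU : IsOpen U) (e : ℝ × ℝ) :
    SmoothOn U fun x y => fderiv ℝ (fun p : ℝ × ℝ => v p.1 p.2) (x, y) e :=
  (ContDiffOn.fderiv_of_isOpen (m := ∞) hv hU (by simp)).clm_apply contDiffOn_const

lemma SmoothOn.deriv_fst_eq (hv : SmoothOn U v) (hU : IsOpen U) (hp : (x, y) ∈ U) :
    deriv (fun s => v s y) x = fderiv ℝ (fun p : ℝ × ℝ => v p.1 p.2) (x, y) (1, 0) :=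
  (hasDerivAt_slice_fst (hv.hasFDerivAt hU hp)).deriv

lemma SmoothOn.deriv_snd_eq (hv : SmoothOn U v) (hU : IsOpen U) (hp : (x, y) ∈ U) :
    deriv (fun z => v x z) y = fderiv ℝ (fun p : ℝ × ℝ => v p.1 p.2) (x, y) (0, 1) :=
  (hasDerivAt_slice_snd (hv.hasFDerivAt hU hp)).deriv

lemma SmoothOn.deriv_fst (hv : SmoothOn U v) (hU : IsOpen U) :
    SmoothOn U fun x y => deriv (fun s => v s y) x :=
  (hv.fderiv_apply hU (1, 0)).congr fun _ _ hp => hv.deriv_fst_eq hU hp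

lemma SmoothOn.deriv_snd (hv : SmoothOn U v) (hU : IsOpen U) :
    SmoothOn U fun x y => deriv (fun z => v x z) y :=
  (hv.fderiv_apply hU (0, 1)).congr fun _ _ hp => hv.deriv_snd_eq hU hp

lemma SmoothOn.deriv_comm (hv : SmoothOn U v) (hU : IsOpen U) (hp : (x, y) ∈ U) :
    deriv (fun z => deriv (fun s => v s z) x) y = deriv (fun s => deriv (fun z => v s z) y) x := by
  set V : ℝ × ℝ → ℝ := fun p => v p.1 p.2 with hV
  have hVat : ContDiffAt ℝ ∞ V (x, y) := hv.contDiffAt hU hp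
  have hd : HasFDerivAt (fderiv ℝ V) (fderiv ℝ (fderiv ℝ V) (x, y)) (x, y) :=
    ((hVat.fderiv_right (m := ∞) (by simp)).differentiableAt (by simp)).hasFDerivAt
  have h1 : deriv (fun z => deriv (fun s => v s z) x) y =
      fderiv ℝ (fderiv ℝ V) (x, y) (0, 1) (1, 0) := by
    have e : (fun z => deriv (fun s => v s z) x) =ᶠ[𝓝 y] fun z => fderiv ℝ V (x, z) (1, 0) := by
      filter_upwards [eventually_slice_snd hU hp] with z hz
      exact hv.deriv_fst_eq hU hz
    rw [e.deriv_eq]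
    have := hd.clm_apply (hasFDerivAt_const ((1, 0) : ℝ × ℝ) (x, y))
    simpa using (hasDerivAt_slice_snd this).deriv
  have h2 : deriv (fun s => deriv (fun z => v s z) y) x =
      fderiv ℝ (fderiv ℝ V) (x, y) (1, 0) (0, 1) := by
    have e : (fun s => deriv (fun z => v s z) y) =ᶠ[𝓝 x] fun s => fderiv ℝ V (s, y) (0, 1) := by
      filter_upwards [eventually_slice_fst hU hp] with s hs
      exact hv.deriv_snd_eq hU hs
    rw [e.deriv_eq]
    have := hd.clm_apply (hasFDerivAt_const ((0, 1) : ℝ × ℝ) (x, y))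
    simpa using (hasDerivAt_slice_fst this).deriv
  rw [h1, h2]
  exact hVat.isSymmSndFDerivAt 
    (by simpa using WithTop.coe_le_coe.2 (le_top : (2 : ℕ∞) ≤ ⊤)) _ _

lemma SmoothOn.pd (hv : SmoothOn U v) (hU : IsOpen U) (m n : ℕ) : SmoothOn U (pd m n v) := by
  induction m with
  | zero =>
    induction n with
    | zero => exact hv.congr fun x y _ => pd_zero_zero v x y
    | succ n ih => exact (ih.deriv_snd hU).congr fun x y _ => pd_zero_succ n v x y
  | succ m ih => exact (ih.deriv_fst hU).congr fun x y _ => pd_succ_left m n v x y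

/-- In `pd` the `y`-derivatives are taken first; symmetry of second derivatives moves a further one
past the `x`-derivatives one by one. -/
lemma SmoothOn.deriv_snd_pd (hv : SmoothOn U v) (hU : IsOpen U) (m n : ℕ) (hp : (x, y) ∈ U) :
    deriv (fun z => CompactFDM.pd m n v x z) y = CompactFDM.pd m (n + 1) v x y := by
  induction m generalizing x y with
  | zero => rw [pd_zero_succ]
  | succ m ih =>
    simp only [pd_succ_left]
    rw [(hv.pd hU m n).deriv_comm hU hp]
    refine EventuallyEq.deriv_eq ?_
    filter_upwards [eventually_slice_fst hU hp] with s hs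
    exact ih hs

lemma SmoothOn.pd_pd (hv : SmoothOn U v) (hU : IsOpen U) (m n p q : ℕ) (hp : (x, y) ∈ U) :
    CompactFDM.pd p q (CompactFDM.pd m n v) x y = CompactFDM.pd (m + p) (n + q) v x y := by
  induction p generalizing x y with
  | zero =>
    induction q generalizing x y with
    | zero => simp
    | succ q ih =>
      rw [pd_zero_succ, ← add_assoc, ← hv.deriv_snd_pd hU _ _ hp]
      refine EventuallyEq.deriv_eq ?_
      filter_upwards [eventually_slice_snd hU hp] with z hz
      exact ih hz
  | succ p ih =>
    rw [pd_succ_left, ← add_assoc, pd_succ_left]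
    refine EventuallyEq.deriv_eq ?_
    filter_upwards [eventually_slice_fst hU hp] with s hs
    exact ih hs

lemma SmoothOn.contDiffAt_fst (hv : SmoothOn U v) (hU : IsOpen U) (hp : (x, y) ∈ U) (n : ℕ) :
    ContDiffAt ℝ n (fun s => v s y) x :=
  ((hv.contDiffAt hU hp).comp x (f := fun s => (s, y))
    (contDiffAt_id.prodMk contDiffAt_const)).of_le (by exact_mod_cast le_top)

lemma SmoothOn.contDiffAt_snd (hv : SmoothOn U v) (hU : IsOpen U) (hp : (x, y) ∈ U) (n : ℕ) :
    ContDiffAt ℝ n (fun z => v x z) y :=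
  ((hv.contDiffAt hU hp).comp y (f := fun z => (x, z))
    (contDiffAt_const.prodMk contDiffAt_id)).of_le (by exact_mod_cast le_top)

lemma pd_eq_iteratedDeriv_pd (m n : ℕ) (v : ℝ → ℝ → ℝ) (x y : ℝ) :
    pd m n v x y = iteratedDeriv m (fun s => pd 0 n v s y) x := by
  simp only [pd_zero_left]
  rfl

lemma pd_add (hv : SmoothOn U v) (hw : SmoothOn U w) (hU : IsOpen U) (m n : ℕ)
    (hp : (x, y) ∈ U) : pd m n (fun x y => v x y + w x y) x y = pd m n v x y + pd m n w x y := by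
  simp only [pd_eq_iteratedDeriv_pd m n]
  rw [← iteratedDeriv_fun_add ((hv.pd hU 0 n).contDiffAt_fst hU hp m)
    ((hw.pd hU 0 n).contDiffAt_fst hU hp m)]
  refine EventuallyEq.eq_of_nhds (EventuallyEq.iteratedDeriv ?_ m)
  filter_upwards [eventually_slice_fst hU hp] with s hs
  simp only [pd_zero_left]
  exact iteratedDeriv_fun_add (hv.contDiffAt_snd hU hs n) (hw.contDiffAt_snd hU hs n)

lemma pd_sub (hv : SmoothOn U v) (hw : SmoothOn U w) (hU : IsOpen U) (m n : ℕ)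
    (hp : (x, y) ∈ U) : pd m n (fun x y => v x y - w x y) x y = pd m n v x y - pd m n w x y := by
  simp only [pd_eq_iteratedDeriv_pd m n]
  rw [← iteratedDeriv_fun_sub ((hv.pd hU 0 n).contDiffAt_fst hU hp m)
    ((hw.pd hU 0 n).contDiffAt_fst hU hp m)]
  refine EventuallyEq.eq_of_nhds (EventuallyEq.iteratedDeriv ?_ m)
  filter_upwards [eventually_slice_fst hU hp] with s hs
  simp only [pd_zero_left]
  exact iteratedDeriv_fun_sub (hv.contDiffAt_snd hU hs n) (hw.contDiffAt_snd hU hs n)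

lemma pd_div_const (v : ℝ → ℝ → ℝ) (e : ℝ) (m n : ℕ) (x y : ℝ) :
    pd m n (fun x y => v x y / e) x y = pd m n v x y / e := by
  simp only [pd, iteratedDeriv_div_const]

/-- Leibniz' rule for mixed partial derivatives. -/
lemma pd_mul (hv : SmoothOn U v) (hw : SmoothOn U w) (hU : IsOpen U) (m n : ℕ)
    (hp : (x, y) ∈ U) : pd m n (fun x y => v x y * w x y) x y =
      ∑ i ∈ Finset.range (m + 1), ∑ j ∈ Finset.range (n + 1),
        ((m.choose i * n.choose j : ℕ) : ℝ) * (pd i j v x y * pd (m - i) (n - j) w x y) := by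
  have h1 : pd m n (fun x y => v x y * w x y) x y = iteratedDeriv m
      (fun s => ∑ j ∈ Finset.range (n + 1), (n.choose j : ℝ) * (pd 0 j v s y * pd 0 (n - j) w s y))
        x := by
    rw [pd_eq_iteratedDeriv_pd]
    refine EventuallyEq.eq_of_nhds (EventuallyEq.iteratedDeriv ?_ m)
    filter_upwards [eventually_slice_fst hU hp] with s hs
    simp only [pd_zero_left]
    rw [iteratedDeriv_fun_mul (hv.contDiffAt_snd hU hs n) (hw.contDiffAt_snd hU hs n)]
    simp only [mul_assoc]
  have hc : ∀ j, ContDiffAt ℝ m (fun s => pd 0 j v s y) x := fun j =>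
    (hv.pd hU 0 j).contDiffAt_fst hU hp m
  have hc' : ∀ j, ContDiffAt ℝ m (fun s => pd 0 j w s y) x := fun j =>
    (hw.pd hU 0 j).contDiffAt_fst hU hp m
  rw [h1, iteratedDeriv_fun_sum fun j _ => contDiffAt_const.mul ((hc j).mul (hc' (n - j))),
    Finset.sum_comm]
  refine Finset.sum_congr rfl fun j _ => ?_
  rw [iteratedDeriv_const_mul_field, iteratedDeriv_fun_mul (hc j) (hc' (n - j)), Finset.mul_sum]
  refine Finset.sum_congr rfl fun i _ => ?_
  rw [← pd_eq_iteratedDeriv_pd, ← pd_eq_iteratedDeriv_pd]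
  push_cast
  ring

lemma SmoothOn.add (hv : SmoothOn U v) (hw : SmoothOn U w) :
    SmoothOn U fun x y => v x y + w x y :=
  ContDiffOn.add hv hw

lemma SmoothOn.sub (hv : SmoothOn U v) (hw : SmoothOn U w) :
    SmoothOn U fun x y => v x y - w x y :=
  ContDiffOn.sub hv hw

lemma SmoothOn.mul (hv : SmoothOn U v) (hw : SmoothOn U w) :
    SmoothOn U fun x y => v x y * w x y :=
  ContDiffOn.mul hv hw

lemma SmoothOn.div_const (hv : SmoothOn U v) (e : ℝ) : SmoothOn U fun x y => v x y / e :=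
  ContDiffOn.div_const hv e

/-- The derivatives of a solution of the equation satisfy the differentiated equations. -/
lemma isJet_of_eq {a b d f u : ℝ → ℝ → ℝ} (hU : IsOpen U) (ha : SmoothOn U a) (hb : SmoothOn U b)
    (hd : SmoothOn U d) (hf : SmoothOn U f) (hu : SmoothOn U u)
    (h : ∀ x y, (x, y) ∈ U → pd 2 0 u x y = f x y - pd 0 2 u x y -
      (a x y * pd 1 0 u x y + b x y * pd 0 1 u x y + d x y * u x y)) (hp : (x, y) ∈ U) (N : ℕ) :
    IsJet N (jet a x y) (jet b x y) (jet d x y) (jet f x y) (jet u x y) := by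
  intro p q _
  have h10 := ha.mul (hu.pd hU 1 0)
  have h01 := hb.mul (hu.pd hU 0 1)
  have h00 := hd.mul hu
  simp only [jet, elimStep]
  -- Apply `∂ₓ^p ∂_y^q` to the equation for `u_xx`; Leibniz' rule produces the double sum of
  -- `elimStep`.
  rw [show pd (p + 2) q u x y = pd p q (pd 2 0 u) x y by
      rw [hu.pd_pd hU 2 0 p q hp, add_comm p, zero_add], pd_congr hU h p q hp,
    pd_sub (hf.sub (hu.pd hU 0 2)) ((h10.add h01).add h00) hU p q hp,
    pd_sub hf (hu.pd hU 0 2) hU p q hp, pd_add (h10.add h01) h00 hU p q hp,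
    pd_add h10 h01 hU p q hp, pd_mul ha (hu.pd hU 1 0) hU p q hp,
    pd_mul hb (hu.pd hU 0 1) hU p q hp, pd_mul hd hu hU p q hp, hu.pd_pd hU 0 2 p q hp, zero_add,
    add_comm 2 q]
  congr 1
  simp only [Finset.sum_range, ← Finset.sum_add_distrib]
  refine Finset.sum_congr rfl fun i _ => Finset.sum_congr rfl fun j _ => ?_
  have hi := i.2
  have hj := j.2
  rw [hu.pd_pd hU 1 0 _ _ hp, hu.pd_pd hU 0 1 _ _ hp, zero_add, zero_add,
    show 1 + (p - i : ℕ) = p + 1 - i by omega, show 1 + (q - j : ℕ) = q + 1 - j by omega]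
  ring

end PartialDerivatives

/-! ### Bounds for the derivatives of the data -/

section Data

open Filter Topology Set

/-- The interior of the square. -/
def openSquare (l₁ l₂ : ℝ) : Set (ℝ × ℝ) := Ioo l₁ l₂ ×ˢ Ioo l₁ l₂

lemma isOpen_openSquare (l₁ l₂ : ℝ) : IsOpen (openSquare l₁ l₂) := isOpen_Ioo.prod isOpen_Ioo

variable {l₁ l₂ T : ℝ}

lemma uniqueDiffOn_box (hl : l₁ < l₂) (hT : 0 < T) :
    UniqueDiffOn ℝ (Icc l₁ l₂ ×ˢ (Icc l₁ l₂ ×ˢ Icc 0 T)) :=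
  (uniqueDiffOn_Icc hl).prod ((uniqueDiffOn_Icc hl).prod (uniqueDiffOn_Icc hT))

/-- The derivative within the closed box is smooth up to the boundary and equals the ordinary one at
interior `x`. The time may be an endpoint, since only `x` varies. -/
lemma SmoothXYT.deriv_fst {g : ℝ → ℝ → ℝ → ℝ} (hg : SmoothXYT l₁ l₂ T g) (hl : l₁ < l₂)
    (hT : 0 < T) : ∃ g', SmoothXYT l₁ l₂ T g' ∧ ∀ t ∈ Icc 0 T, ∀ x ∈ Ioo l₁ l₂, ∀ y ∈ Ioo l₁ l₂,
      deriv (fun s => g s y t) x = g' x y t := by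
  refine ⟨fun x y t => fderivWithin ℝ (fun p : ℝ × ℝ × ℝ => g p.1 p.2.1 p.2.2)
    (Icc l₁ l₂ ×ˢ (Icc l₁ l₂ ×ˢ Icc 0 T)) (x, y, t) (1, 0, 0), ?_, fun t ht x hx y hy => ?_⟩
  · exact (ContDiffOn.fderivWithin (m := ∞) hg (uniqueDiffOn_box hl hT) (by simp)).clm_apply
      contDiffOn_const
  · have hm : (x, y, t) ∈ Icc l₁ l₂ ×ˢ (Icc l₁ l₂ ×ˢ Icc 0 T) :=
      ⟨Ioo_subset_Icc_self hx, Ioo_subset_Icc_self hy, ht⟩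
    have h1 := ((ContDiffOn.differentiableOn hg (by simp)) _ hm).hasFDerivWithinAt
    have h2 : HasDerivWithinAt (fun s : ℝ => (s, y, t)) ((1 : ℝ), (0 : ℝ), (0 : ℝ))
        (Icc l₁ l₂) x :=
      (hasDerivWithinAt_id x _).prodMk ((hasDerivWithinAt_const x _ y).prodMk
        (hasDerivWithinAt_const x _ t))
    have h3 := h1.comp_hasDerivWithinAt x h2 (t := Icc l₁ l₂ ×ˢ (Icc l₁ l₂ ×ˢ Icc 0 T))
      fun s hs => ⟨hs, Ioo_subset_Icc_self hy, ht⟩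
    exact (h3.hasDerivAt (Icc_mem_nhds hx.1 hx.2)).deriv

lemma SmoothXYT.deriv_snd {g : ℝ → ℝ → ℝ → ℝ} (hg : SmoothXYT l₁ l₂ T g) (hl : l₁ < l₂)
    (hT : 0 < T) : ∃ g', SmoothXYT l₁ l₂ T g' ∧ ∀ t ∈ Icc 0 T, ∀ x ∈ Ioo l₁ l₂, ∀ y ∈ Ioo l₁ l₂,
      deriv (fun z => g x z t) y = g' x y t := by
  refine ⟨fun x y t => fderivWithin ℝ (fun p : ℝ × ℝ × ℝ => g p.1 p.2.1 p.2.2)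
    (Icc l₁ l₂ ×ˢ (Icc l₁ l₂ ×ˢ Icc 0 T)) (x, y, t) (0, 1, 0), ?_, fun t ht x hx y hy => ?_⟩
  · exact (ContDiffOn.fderivWithin (m := ∞) hg (uniqueDiffOn_box hl hT) (by simp)).clm_apply
      contDiffOn_const
  · have hm : (x, y, t) ∈ Icc l₁ l₂ ×ˢ (Icc l₁ l₂ ×ˢ Icc 0 T) :=
      ⟨Ioo_subset_Icc_self hx, Ioo_subset_Icc_self hy, ht⟩
    have h1 := ((ContDiffOn.differentiableOn hg (by simp)) _ hm).hasFDerivWithinAt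
    have h2 : HasDerivWithinAt (fun z : ℝ => (x, z, t)) ((0 : ℝ), (1 : ℝ), (0 : ℝ))
        (Icc l₁ l₂) y :=
      (hasDerivWithinAt_const y _ x).prodMk ((hasDerivWithinAt_id y _).prodMk
        (hasDerivWithinAt_const y _ t))
    have h3 := h1.comp_hasDerivWithinAt y h2 (t := Icc l₁ l₂ ×ˢ (Icc l₁ l₂ ×ˢ Icc 0 T))
      fun z hz => ⟨Ioo_subset_Icc_self hx, hz, ht⟩
    exact (h3.hasDerivAt (Icc_mem_nhds hy.1 hy.2)).deriv

/-- The family `v t` agrees inside the square with a function smooth up to the boundary. -/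
def HasSmoothExtension (l₁ l₂ T : ℝ) (v : ℝ → ℝ → ℝ → ℝ) : Prop :=
  ∃ g, SmoothXYT l₁ l₂ T g ∧
    ∀ t ∈ Icc 0 T, ∀ x ∈ Ioo l₁ l₂, ∀ y ∈ Ioo l₁ l₂, v t x y = g x y t

variable {v : ℝ → ℝ → ℝ → ℝ}

lemma SmoothXYT.hasSmoothExtension {g : ℝ → ℝ → ℝ → ℝ} (hg : SmoothXYT l₁ l₂ T g) :
    HasSmoothExtension l₁ l₂ T fun t x y => g x y t :=
  ⟨g, hg, fun _ _ _ _ _ _ => rfl⟩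

lemma HasSmoothExtension.pd (hv : HasSmoothExtension l₁ l₂ T v) (hl : l₁ < l₂) (hT : 0 < T)
    (m n : ℕ) : HasSmoothExtension l₁ l₂ T fun t x y => pd m n (v t) x y := by
  induction m with
  | zero =>
    induction n with
    | zero => simpa using hv
    | succ n ih =>
      obtain ⟨g, hg, h⟩ := ih
      obtain ⟨g', hg', h'⟩ := hg.deriv_snd hl hT
      refine ⟨g', hg', fun t ht x hx y hy => ?_⟩
      beta_reduce
      rw [pd_zero_succ, ← h' t ht x hx y hy]
      refine EventuallyEq.deriv_eq ?_
      filter_upwards [Ioo_mem_nhds hy.1 hy.2] with z hz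
      exact h t ht x hx z hz
  | succ m ih =>
    obtain ⟨g, hg, h⟩ := ih
    obtain ⟨g', hg', h'⟩ := hg.deriv_fst hl hT
    refine ⟨g', hg', fun t ht x hx y hy => ?_⟩
    beta_reduce
    rw [pd_succ_left, ← h' t ht x hx y hy]
    refine EventuallyEq.deriv_eq ?_
    filter_upwards [Ioo_mem_nhds hx.1 hx.2] with s hs
    exact h t ht s hs y hy

lemma HasSmoothExtension.smoothOn (hv : HasSmoothExtension l₁ l₂ T v) {t : ℝ}
    (ht : t ∈ Icc 0 T) : SmoothOn (openSquare l₁ l₂) (v t) := by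
  obtain ⟨g, hg, h⟩ := hv
  refine SmoothOn.congr (v := fun x y => g x y t) ?_ fun x y hp => h t ht x hp.1 y hp.2
  refine ContDiffOn.comp (t := Icc l₁ l₂ ×ˢ (Icc l₁ l₂ ×ˢ Icc 0 T)) (f := fun p : ℝ × ℝ =>
    (p.1, p.2, t)) hg ?_ fun p hp => ⟨Ioo_subset_Icc_self hp.1, Ioo_subset_Icc_self hp.2, ht⟩
  exact (contDiff_fst.prodMk (contDiff_snd.prodMk contDiff_const)).contDiffOn

/-- Ordinary derivatives on the boundary depend on values outside the square; the extension supplies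
compactness, hence one bound for all times and interior points. -/
lemma HasSmoothExtension.bounded (hv : HasSmoothExtension l₁ l₂ T v) :
    ∃ K, ∀ t ∈ Icc 0 T, ∀ x ∈ Ioo l₁ l₂, ∀ y ∈ Ioo l₁ l₂, |v t x y| ≤ K := by
  obtain ⟨g, hg, h⟩ := hv
  have hc : IsCompact (Icc l₁ l₂ ×ˢ (Icc l₁ l₂ ×ˢ Icc 0 T)) :=
    isCompact_Icc.prod (isCompact_Icc.prod isCompact_Icc)
  obtain ⟨K, hK⟩ := hc.exists_bound_of_continuousOn (ContDiffOn.continuousOn hg)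
  refine ⟨K, fun t ht x hx y hy => ?_⟩
  rw [h t ht x hx y hy]
  exact hK (x, y, t) ⟨Ioo_subset_Icc_self hx, Ioo_subset_Icc_self hy, ht⟩

lemma HasSmoothExtension.sub {w : ℝ → ℝ → ℝ → ℝ} (hv : HasSmoothExtension l₁ l₂ T v)
    (hw : HasSmoothExtension l₁ l₂ T w) :
    HasSmoothExtension l₁ l₂ T fun t x y => v t x y - w t x y := by
  obtain ⟨g, hg, h⟩ := hv
  obtain ⟨g', hg', h'⟩ := hw
  exact ⟨fun x y t => g x y t - g' x y t, ContDiffOn.sub hg hg', fun t ht x hx y hy => by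
    simp only [h t ht x hx y hy, h' t ht x hx y hy]⟩

lemma HasSmoothExtension.neg (hv : HasSmoothExtension l₁ l₂ T v) :
    HasSmoothExtension l₁ l₂ T fun t x y => -v t x y := by
  obtain ⟨g, hg, h⟩ := hv
  exact ⟨fun x y t => -g x y t, ContDiffOn.neg hg, fun t ht x hx y hy => by
    simp only [h t ht x hx y hy]⟩

lemma HasSmoothExtension.div {k : ℝ → ℝ → ℝ → ℝ} (hv : HasSmoothExtension l₁ l₂ T v)
    (hk : SmoothXYT l₁ l₂ T k)
    (h0 : ∀ x ∈ Icc l₁ l₂, ∀ y ∈ Icc l₁ l₂, ∀ t ∈ Icc 0 T, 0 < k x y t) :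
    HasSmoothExtension l₁ l₂ T fun t x y => v t x y / k x y t := by
  obtain ⟨g, hg, h⟩ := hv
  exact ⟨fun x y t => g x y t / k x y t, ContDiffOn.div hg hk fun p hp =>
    (h0 p.1 hp.1 p.2.1 hp.2.1 p.2.2 hp.2.2).ne', fun t ht x hx y hy => by
    simp only [h t ht x hx y hy]⟩

variable {P : ParabolicData}

lemma hasSmoothExtension_a (hP : P.Admissible l₁ l₂ T) (hl : l₁ < l₂) (hT : 0 < T) :
    HasSmoothExtension l₁ l₂ T P.a :=
  ((hP.smooth_kappa.hasSmoothExtension.pd hl hT 1 0).sub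
    hP.smooth_alpha.hasSmoothExtension).div hP.smooth_kappa hP.kappa_pos

lemma hasSmoothExtension_b (hP : P.Admissible l₁ l₂ T) (hl : l₁ < l₂) (hT : 0 < T) :
    HasSmoothExtension l₁ l₂ T P.b :=
  ((hP.smooth_kappa.hasSmoothExtension.pd hl hT 0 1).sub
    hP.smooth_beta.hasSmoothExtension).div hP.smooth_kappa hP.kappa_pos

lemma hasSmoothExtension_d₁ (hP : P.Admissible l₁ l₂ T) (μ : Method) :
    HasSmoothExtension l₁ l₂ T (P.d₁ μ) :=
  (SmoothXYT.hasSmoothExtension (g := fun _ _ _ => -μ.lead) contDiffOn_const).div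
    hP.smooth_kappa hP.kappa_pos

lemma hasSmoothExtension_d₂ (hP : P.Admissible l₁ l₂ T) : HasSmoothExtension l₁ l₂ T P.d₂ :=
  hP.smooth_lam.hasSmoothExtension.neg.div hP.smooth_kappa hP.kappa_pos

lemma hasSmoothExtension_f₁ (hP : P.Admissible l₁ l₂ T) : HasSmoothExtension l₁ l₂ T P.f₁ :=
  hP.smooth_phi.hasSmoothExtension.neg.div hP.smooth_kappa hP.kappa_pos

end Data

/-! ### Taylor's formula up to the boundary of the square -/

section Taylor

open Filter Topology Set

/-- A crude Taylor estimate for a chain of derivatives on `[0, 1)`. -/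
lemma abs_sub_taylor_le {B : ℝ} (n : ℕ) : ∀ F : ℕ → ℝ → ℝ,
    (∀ k < n, ∀ s ∈ Ico (0 : ℝ) 1, HasDerivAt (F k) (F (k + 1) s) s) →
    (∀ s ∈ Ico (0 : ℝ) 1, |F n s| ≤ B) → ∀ s ∈ Ico (0 : ℝ) 1,
      |F 0 s - ∑ k ∈ Finset.range n, F k 0 * s ^ k / k.factorial| ≤ B := by
  induction n with
  | zero => intro F _ hB s hs; simpa using hB s hs
  | succ n ih =>
    intro F hF hB s hs
    set E : ℝ → ℝ := fun s => F 0 s - ∑ k ∈ Finset.range (n + 1), F k 0 * s ^ k / k.factorial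
    set E' : ℝ → ℝ := fun s => F 1 s - ∑ k ∈ Finset.range n, F (k + 1) 0 * s ^ k / k.factorial
    have hE' : ∀ s ∈ Ico (0 : ℝ) 1, |E' s| ≤ B :=
      -- The derivative of a Taylor remainder is the remainder of the shifted chain, so the bound
      -- integrates.
      ih (fun k => F (k + 1)) (fun k hk => hF (k + 1) (by omega)) hB
    have hE : ∀ s ∈ Ico (0 : ℝ) 1, HasDerivAt E (E' s) s := by
      intro s hs
      refine (hF 0 (by omega) s hs).sub ?_
      have h1 : ∀ k ∈ Finset.range (n + 1), HasDerivAt (fun s : ℝ => F k 0 * s ^ k / k.factorial)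
          (F k 0 * (k * s ^ (k - 1)) / k.factorial) s := fun k _ =>
        ((hasDerivAt_pow k s).const_mul _).div_const _
      have h2 := HasDerivAt.fun_sum h1
      convert h2 using 1
      rw [Finset.sum_range_succ']
      simp only [Nat.cast_zero, zero_mul, mul_zero, zero_div, add_zero, Nat.add_sub_cancel]
      refine Finset.sum_congr rfl fun k _ => ?_
      rw [Nat.factorial_succ]
      have : (k.factorial : ℝ) ≠ 0 := by positivity
      push_cast
      field_simp
    have h0 : E 0 = 0 := by
      simp only [E]
      rw [Finset.sum_range_succ']
      simp
    have hsub : Icc 0 s ⊆ Ico (0 : ℝ) 1 := fun z hz => ⟨hz.1, hz.2.trans_lt hs.2⟩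
    have key := (convex_Icc 0 s).norm_image_sub_le_of_norm_hasDerivWithin_le (C := B)
      (fun z hz => (hE z (hsub hz)).hasDerivWithinAt) (fun z hz => hE' z (hsub hz))
      (left_mem_Icc.2 hs.1) (right_mem_Icc.2 hs.1)
    rw [h0, sub_zero, sub_zero, Real.norm_eq_abs, Real.norm_eq_abs, abs_of_nonneg hs.1] at key
    have hB0 : 0 ≤ B := (abs_nonneg _).trans (hE' s hs)
    exact key.trans (mul_le_of_le_one_right hB0 hs.2.le)

variable {U : Set (ℝ × ℝ)} {v : ℝ → ℝ → ℝ}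

lemma hasDerivAt_line (hv : SmoothOn U v) (hU : IsOpen U) {x y δ ε s : ℝ}
    (hp : (x + s * δ, y + s * ε) ∈ U) :
    HasDerivAt (fun s => v (x + s * δ) (y + s * ε))
      (δ * pd 1 0 v (x + s * δ) (y + s * ε) + ε * pd 0 1 v (x + s * δ) (y + s * ε)) s := by
  have h1 := hv.hasFDerivAt hU hp
  have h2 : HasDerivAt (fun s : ℝ => (x + s * δ, y + s * ε)) (δ, ε) s := by
    have := (((hasDerivAt_id s).mul_const δ).const_add x).prodMk
      (((hasDerivAt_id s).mul_const ε).const_add y)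
    simpa using this
  have h3 := h1.comp_hasDerivAt s h2
  refine h3.congr_deriv ?_
  rw [pd_succ_left, pd_zero_succ]
  simp only [pd_zero_zero]
  rw [hv.deriv_fst_eq hU hp, hv.deriv_snd_eq hU hp,
    show ((δ, ε) : ℝ × ℝ) = δ • ((1 : ℝ), (0 : ℝ)) + ε • ((0 : ℝ), (1 : ℝ)) by simp, map_add,
    map_smul, map_smul, smul_eq_mul, smul_eq_mul]

/-- The `k`-th derivative of `v` along a line. -/
def lineDerivative (v : ℝ → ℝ → ℝ) (x y δ ε : ℝ) (k : ℕ) (s : ℝ) : ℝ :=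
  ∑ j ∈ Finset.range (k + 1),
    (k.choose j : ℝ) * (δ ^ j * ε ^ (k - j)) * pd j (k - j) v (x + s * δ) (y + s * ε)

/-- The chain rule and Pascal's rule, checked order by order. -/
lemma hasDerivAt_lineDerivative (hv : SmoothOn U v) (hU : IsOpen U) {x y δ ε s : ℝ}
    (hp : (x + s * δ, y + s * ε) ∈ U) {k : ℕ} (hk : k < 6) :
    HasDerivAt (lineDerivative v x y δ ε k) (lineDerivative v x y δ ε (k + 1) s) s := by
  have h1 : ∀ j ∈ Finset.range (k + 1), HasDerivAt (fun s => (k.choose j : ℝ) *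
      (δ ^ j * ε ^ (k - j)) * pd j (k - j) v (x + s * δ) (y + s * ε))
      ((k.choose j : ℝ) * (δ ^ j * ε ^ (k - j)) *
        (δ * pd (j + 1) (k - j) v (x + s * δ) (y + s * ε) +
          ε * pd j (k - j + 1) v (x + s * δ) (y + s * ε))) s := by
    intro j _
    have := hasDerivAt_line (hv.pd hU j (k - j)) hU hp
    rw [hv.pd_pd hU j (k - j) 1 0 hp, hv.pd_pd hU j (k - j) 0 1 hp] at this
    exact this.const_mul _
  refine (HasDerivAt.fun_sum h1).congr_deriv ?_
  unfold lineDerivative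
  interval_cases k <;> simp [Finset.sum_range_succ, Nat.choose] <;> ring

lemma abs_lineDerivative_le {x y δ ε s h M : ℝ} (hδ : |δ| ≤ h) (hε : |ε| ≤ h) (k : ℕ)
    (hM : ∀ j, j ≤ k → |pd j (k - j) v (x + s * δ) (y + s * ε)| ≤ M) :
    |lineDerivative v x y δ ε k s| ≤ 2 ^ k * h ^ k * M := by
  have h0 : 0 ≤ h := (abs_nonneg _).trans hδ
  calc |lineDerivative v x y δ ε k s|
      ≤ ∑ j ∈ Finset.range (k + 1), (k.choose j : ℝ) * (h ^ k * M) := by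
        refine (Finset.abs_sum_le_sum_abs _ _).trans (Finset.sum_le_sum fun j hj => ?_)
        have hj : j ≤ k := by rw [Finset.mem_range] at hj; omega
        rw [abs_mul, abs_mul, abs_mul, abs_pow, abs_pow, Nat.abs_cast, mul_assoc]
        have e : h ^ k = h ^ j * h ^ (k - j) := by rw [← pow_add]; congr 1; omega
        rw [e]
        have := hM j hj
        gcongr
    _ = 2 ^ k * h ^ k * M := by
        rw [← Finset.sum_mul, ← Nat.cast_sum, Nat.sum_range_choose]
        push_cast
        ring

/-- A segment from an interior point to a point of the closed interval stays inside except possibly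
at its end. -/
lemma add_mul_mem_Ioo {l₁ l₂ x δ s : ℝ} (hx : x ∈ Ioo l₁ l₂) (hδ : x + δ ∈ Icc l₁ l₂)
    (hs : s ∈ Ico (0 : ℝ) 1) : x + s * δ ∈ Ioo l₁ l₂ := by
  obtain ⟨h1, h2⟩ := hx
  obtain ⟨h3, h4⟩ := hδ
  obtain ⟨h5, h6⟩ := hs
  constructor <;> nlinarith

lemma lineDerivative_sum (v : ℝ → ℝ → ℝ) (x y h : ℝ) (r l : ℤ) :
    ∑ k ∈ Finset.range 6, lineDerivative v x y (r * h) (l * h) k 0 / k.factorial =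
      realTaylor (fun p q => h ^ (p + q) * jet v x y p q) r l := by
  simp [lineDerivative, realTaylor, jet, Finset.sum_range_succ, Nat.choose, Nat.factorial]
  ring

/-- Taylor's formula for a function which is smooth on the closed square. -/
lemma abs_sub_realTaylor_le {l₁ l₂ x y h M : ℝ} {u : ℝ → ℝ → ℝ} (hu : SmoothXY l₁ l₂ u)
    (hx : x ∈ Ioo l₁ l₂) (hy : y ∈ Ioo l₁ l₂) (h0 : 0 ≤ h)
    (hM : ∀ p q : ℕ, p + q ≤ 6 → ∀ x ∈ Ioo l₁ l₂, ∀ y ∈ Ioo l₁ l₂, |pd p q u x y| ≤ M) {r l : ℤ}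
    (hr : r ∈ offs) (hl : l ∈ offs) (hxr : x + r * h ∈ Icc l₁ l₂) (hyl : y + l * h ∈ Icc l₁ l₂) :
    |u (x + r * h) (y + l * h) - realTaylor (fun p q => h ^ (p + q) * jet u x y p q) r l| ≤
      64 * M * h ^ 6 := by
  have hs : SmoothOn (openSquare l₁ l₂) u :=
    ContDiffOn.mono hu (prod_mono Ioo_subset_Icc_self Ioo_subset_Icc_self)
  have habs : ∀ r ∈ offs, |(r : ℝ) * h| ≤ h := by
    intro r hr
    rw [mem_offs] at hr
    rcases hr with rfl | rfl | rfl <;> simp [abs_of_nonneg h0, h0]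
  have hmem : ∀ s ∈ Ico (0 : ℝ) 1, (x + s * (r * h), y + s * (l * h)) ∈ openSquare l₁ l₂ :=
    fun s hs => ⟨add_mul_mem_Ioo hx hxr hs, add_mul_mem_Ioo hy hyl hs⟩
  -- The constant `64 = 2^6` is the sum of the binomial coefficients in the sixth derivative along
  -- the segment.
  have h1 := abs_sub_taylor_le (B := 64 * M * h ^ 6) 6 (lineDerivative u x y (r * h) (l * h))
    (fun k hk s hs' => hasDerivAt_lineDerivative hs (isOpen_openSquare l₁ l₂) (hmem s hs') hk)
    (fun s hs' => (abs_lineDerivative_le (habs r hr) (habs l hl) 6 fun j hj =>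
      hM j (6 - j) (by omega) _ (hmem s hs').1 _ (hmem s hs').2).trans (le_of_eq (by ring)))
  -- The end node may lie on the boundary, where `pd` is not controlled. The estimate holds for `s <
  -- 1` and passes to `s = 1` by continuity of `u` on the closed square.
  have hcont : ContinuousOn (fun s : ℝ => u (x + s * (r * h)) (y + s * (l * h))) (Icc 0 1) := by
    refine ContinuousOn.comp (t := Icc l₁ l₂ ×ˢ Icc l₁ l₂) (g := fun p : ℝ × ℝ => u p.1 p.2)
      (f := fun s : ℝ => (x + s * (r * h), y + s * (l * h))) (ContDiffOn.continuousOn hu)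
      (by fun_prop) fun s hs' => ?_
    rcases hs'.2.eq_or_lt with rfl | hlt
    · simpa only [one_mul] using mk_mem_prod hxr hyl
    · exact prod_mono Ioo_subset_Icc_self Ioo_subset_Icc_self (hmem s ⟨hs'.1, hlt⟩)
  have hcont2 : ContinuousOn (fun s : ℝ => |u (x + s * (r * h)) (y + s * (l * h)) -
      ∑ k ∈ Finset.range 6, lineDerivative u x y (r * h) (l * h) k 0 * s ^ k / k.factorial|)
      (Icc 0 1) :=
    (hcont.sub (by fun_prop)).abs
  have hlim := (hcont2 1 (by simp)).mono_left (nhdsWithin_mono 1 Ico_subset_Icc_self)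
  have hne : (𝓝[Ico (0 : ℝ) 1] 1).NeBot := by
    rw [nhdsWithin_Ico_eq_nhdsLT zero_lt_one]; infer_instance
  have hle := le_of_tendsto hlim (by
    filter_upwards [self_mem_nhdsWithin] with s hs'
    have := h1 s hs'
    simpa only [lineDerivative, zero_add, Finset.sum_range_one, Nat.choose_self, Nat.cast_one,
      pow_zero, tsub_self, mul_one, one_mul, pd_zero_zero] using this)
  simpa [← lineDerivative_sum] using hle

end Taylor

/-! ### Consistency of the scheme -/

section Final

open Set

section Source

variable {ι : Type*} {a b d₁ d₂ f₁ f₂ U : ι → ℕ → ℕ → ℝ} {ρ L : ℝ} {h : ι → ℝ}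

/-- The source built from previous time levels is controlled by the new one. -/
lemma bddFam_f₂ (hρ : ρ ≠ 0) (ha : ∀ p q, BddFam fun i => a i p q)
    (hb : ∀ p q, BddFam fun i => b i p q) (hd₁ : ∀ p q, BddFam fun i => d₁ i p q)
    (hd₂ : ∀ p q, BddFam fun i => d₂ i p q) (hf₁ : ∀ p q, BddFam fun i => f₁ i p q)
    (hU : ∀ p q, p + q ≤ 5 → BddFam fun i => U i p q) (h0 : ∀ i, 0 < h i) (hL : ∀ i, h i ≤ L)
    (hjet : ∀ i, IsJet 5 (a i) (b i) (fun p q => d₁ i p q / (ρ * h i) + d₂ i p q)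
      (fun p q => f₁ i p q + f₂ i p q / (ρ * h i)) (U i)) (p q : ℕ) (hpq : p + q ≤ 3) :
    BddFam fun i => f₂ i p q := by
  have hh : BddFam h := ⟨L, fun i => by rw [abs_of_pos (h0 i)]; exact hL i⟩
  -- Multiplying the differentiated equation by `τ = ρ h` and solving for `f₂` leaves no negative
  -- power of `h`. Orders up to three of `f₂` use orders up to five of `U`.
  have key : ∀ i, f₂ i p q = ρ * h i * (U i (p + 2) q + U i p (q + 2) - f₁ i p q) +
      ∑ k : Fin (p + 1), ∑ l : Fin (q + 1), ((p.choose k * q.choose l : ℕ) : ℝ) *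
        (ρ * h i * (a i k l * U i (p + 1 - k) (q - l) + b i k l * U i (p - k) (q + 1 - l) +
          d₂ i k l * U i (p - k) (q - l)) + d₁ i k l * U i (p - k) (q - l)) := by
    intro i
    have hτ : ρ * h i ≠ 0 := mul_ne_zero hρ (h0 i).ne'
    have e := hjet i p q (by omega)
    rw [elimStep] at e
    have e2 : ∑ k : Fin (p + 1), ∑ l : Fin (q + 1), ((p.choose k * q.choose l : ℕ) : ℝ) *
        (ρ * h i * (a i k l * U i (p + 1 - k) (q - l) + b i k l * U i (p - k) (q + 1 - l) +
          d₂ i k l * U i (p - k) (q - l)) + d₁ i k l * U i (p - k) (q - l)) =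
        ρ * h i * ∑ k : Fin (p + 1), ∑ l : Fin (q + 1), ((p.choose k * q.choose l : ℕ) : ℝ) *
          (a i k l * U i (p + 1 - k) (q - l) + b i k l * U i (p - k) (q + 1 - l) +
            (d₁ i k l / (ρ * h i) + d₂ i k l) * U i (p - k) (q - l)) := by
      simp only [Finset.mul_sum]
      refine Finset.sum_congr rfl fun k _ => Finset.sum_congr rfl fun l _ => ?_
      generalize ρ * h i = τ at hτ
      field_simp
      ring
    rw [e2, e]
    generalize ρ * h i = τ at hτ
    field_simp
    ring
  simp only [key]
  refine .add (.mul (.mul (.const ρ) hh) (.sub (.add (hU _ _ (by omega)) (hU _ _ (by omega)))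
    (hf₁ p q))) (.sum fun k _ => .sum fun l _ => .mul (.const _) (.add (.mul (.mul (.const ρ) hh)
      (.add (.add (.mul (ha _ _) (hU _ _ ?_)) (.mul (hb _ _) (hU _ _ ?_)))
        (.mul (hd₂ _ _) (hU _ _ ?_)))) (.mul (hd₁ _ _) (hU _ _ ?_))))
  all_goals
    have := k.2
    have := l.2
    omega

end Source

/-- A time step and a grid point, with bounded derivatives of the new value. -/
structure StepConfig (P : ParabolicData) (μ : Method) (ρ l₁ l₂ T M : ℝ) where
  h : ℝ
  t : ℝ
  x : ℝ
  y : ℝ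
  w : ℕ → ℝ → ℝ → ℝ
  u : ℝ → ℝ → ℝ
  h_pos : 0 < h
  h_le : h ≤ l₂ - l₁
  t_mem : t ∈ Icc 0 T
  x_mem : x ∈ Ioo l₁ l₂
  y_mem : y ∈ Ioo l₁ l₂
  x_mem_closed : ∀ r ∈ offs, x + r * h ∈ Icc l₁ l₂
  y_mem_closed : ∀ l ∈ offs, y + l * h ∈ Icc l₁ l₂
  smooth : SmoothXY l₁ l₂ u
  step : ∀ x ∈ Ioo l₁ l₂, ∀ y ∈ Ioo l₁ l₂, P.StepEq μ (ρ * h) w u t x y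
  bound : ∀ p q : ℕ, p + q ≤ 6 → ∀ x ∈ Ioo l₁ l₂, ∀ y ∈ Ioo l₁ l₂, |pd p q u x y| ≤ M

variable {P : ParabolicData} {μ : Method} {ρ l₁ l₂ T M : ℝ}

lemma StepConfig.isJet (z : StepConfig P μ ρ l₁ l₂ T M) (hP : P.Admissible l₁ l₂ T)
    (hl : l₁ < l₂) (hT : 0 < T) (hρ : ρ ≠ 0) :
    IsJet 5 (jet (P.a z.t) z.x z.y) (jet (P.b z.t) z.x z.y)
      (fun p q => jet (P.d₁ μ z.t) z.x z.y p q / (ρ * z.h) + jet (P.d₂ z.t) z.x z.y p q)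
      (fun p q => jet (P.f₁ z.t) z.x z.y p q + jet (P.f₂ μ z.w z.t) z.x z.y p q / (ρ * z.h))
      (jet z.u z.x z.y) := by
  have hτ : ρ * z.h ≠ 0 := mul_ne_zero hρ z.h_pos.ne'
  have hO := isOpen_openSquare l₁ l₂
  have hp : (z.x, z.y) ∈ openSquare l₁ l₂ := ⟨z.x_mem, z.y_mem⟩
  have ha := (hasSmoothExtension_a hP hl hT).smoothOn z.t_mem
  have hb := (hasSmoothExtension_b hP hl hT).smoothOn z.t_mem
  have hd₁ := (hasSmoothExtension_d₁ hP μ).smoothOn z.t_mem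
  have hd₂ := (hasSmoothExtension_d₂ hP).smoothOn z.t_mem
  have hf₁ := (hasSmoothExtension_f₁ hP).smoothOn z.t_mem
  have hu : SmoothOn (openSquare l₁ l₂) z.u :=
    ContDiffOn.mono z.smooth (prod_mono Ioo_subset_Icc_self Ioo_subset_Icc_self)
  have hd := (hd₁.div_const (ρ * z.h)).add hd₂
  -- No smoothness of the previous values is assumed; the equation itself expresses `f₂` through
  -- smooth functions.
  have hf₂ : SmoothOn (openSquare l₁ l₂) (P.f₂ μ z.w z.t) := by
    refine (((((((hu.pd hO 2 0).add (hu.pd hO 0 2)).add (ha.mul (hu.pd hO 1 0))).add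
      (hb.mul (hu.pd hO 0 1))).add (hd.mul hu)).sub hf₁).div_const (1 / (ρ * z.h))).congr
        fun x y hxy => ?_
    have e := z.step x hxy.1 y hxy.2
    rw [ParabolicData.StepEq] at e
    rw [eq_div_iff (one_div_ne_zero hτ)]
    linear_combination -e
  have hf := hf₁.add (hf₂.div_const (ρ * z.h))
  have key := isJet_of_eq hO ha hb hd hf hu (fun x y hxy => by
    have e := z.step x hxy.1 y hxy.2
    rw [ParabolicData.StepEq] at e
    linear_combination e) hp 5
  have e1 : jet (fun x y => P.d₁ μ z.t x y / (ρ * z.h) + P.d₂ z.t x y) z.x z.y =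
      fun p q => jet (P.d₁ μ z.t) z.x z.y p q / (ρ * z.h) + jet (P.d₂ z.t) z.x z.y p q := by
    funext p q
    simp only [jet]
    rw [pd_add (hd₁.div_const (ρ * z.h)) hd₂ hO p q hp, pd_div_const]
  have e2 : jet (fun x y => P.f₁ z.t x y + P.f₂ μ z.w z.t x y / (ρ * z.h)) z.x z.y =
      fun p q => jet (P.f₁ z.t) z.x z.y p q + jet (P.f₂ μ z.w z.t) z.x z.y p q / (ρ * z.h) := by
    funext p q
    simp only [jet]
    rw [pd_add hf₁ (hf₂.div_const (ρ * z.h)) hO p q hp, pd_div_const]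
  rwa [e1, e2] at key

/-- The stencil at the point `(x, y)` and the time `t`. -/
def pointStencil (P : ParabolicData) (μ : Method) (ρ t x y : ℝ) : Stencil :=
  theStencil (jet (P.a t) x y) (jet (P.b t) x y) (jet (P.d₁ μ t) x y) (jet (P.d₂ t) x y) ρ

lemma HasSmoothExtension.bddFam_jet {v : ℝ → ℝ → ℝ → ℝ} (hv : HasSmoothExtension l₁ l₂ T v)
    (hl : l₁ < l₂) (hT : 0 < T) (p q : ℕ) :
    BddFam fun z : StepConfig P μ ρ l₁ l₂ T M => jet (v z.t) z.x z.y p q := by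
  obtain ⟨K, hK⟩ := (hv.pd hl hT p q).bounded
  exact ⟨K, fun z => hK z.t z.t_mem z.x z.x_mem z.y z.y_mem⟩

/-- Taking all steps, grid points, previous values and solutions as one index type makes boundedness
of a family the same as a uniform constant. -/
theorem scheme_consistency (hP : P.Admissible l₁ l₂ T) (hl : l₁ < l₂) (hT : 0 < T)
    (hρ : ρ ≠ 0) : ∃ K, ∀ z : StepConfig P μ ρ l₁ l₂ T M,
      |discreteOp (pointStencil P μ ρ z.t z.x z.y) z.h z.u z.x z.y
        - P.schemeRhs μ ρ z.w z.t z.x z.y (pointStencil P μ ρ z.t z.x z.y) z.h| ≤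
          K * z.h ^ 4 := by
  have ha := (hasSmoothExtension_a hP hl hT).bddFam_jet (P := P) (μ := μ) (ρ := ρ) (M := M) hl hT
  have hb := (hasSmoothExtension_b hP hl hT).bddFam_jet (P := P) (μ := μ) (ρ := ρ) (M := M) hl hT
  have hd₁ := (hasSmoothExtension_d₁ hP μ).bddFam_jet (P := P) (μ := μ) (ρ := ρ) (M := M) hl hT
  have hd₂ := (hasSmoothExtension_d₂ hP).bddFam_jet (P := P) (μ := μ) (ρ := ρ) (M := M) hl hT
  have hf₁ := (hasSmoothExtension_f₁ hP).bddFam_jet (P := P) (μ := μ) (ρ := ρ) (M := M) hl hT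
  have hU : ∀ p q, p + q ≤ 5 →
      BddFam fun z : StepConfig P μ ρ l₁ l₂ T M => jet z.u z.x z.y p q := fun p q hpq =>
    ⟨M, fun z => z.bound p q (by omega) z.x z.x_mem z.y z.y_mem⟩
  have hjet := fun z : StepConfig P μ ρ l₁ l₂ T M => z.isJet hP hl hT hρ
  have hf₂ := bddFam_f₂ hρ ha hb hd₁ hd₂ hf₁ hU (fun z => z.h_pos) (fun z => z.h_le) hjet
  obtain ⟨K, hK⟩ := taylor_consistency hρ ha hb hd₁ hd₂ (fun p q _ => hf₁ p q) hf₂ hU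
    (fun z => z.h_pos) (fun z => z.h_le) hjet
  have hh : BddFam fun z : StepConfig P μ ρ l₁ l₂ T M => z.h :=
    ⟨l₂ - l₁, fun z => by rw [abs_of_pos z.h_pos]; exact z.h_le⟩
  have hpow : ∀ p : ℕ, BddFam fun z : StepConfig P μ ρ l₁ l₂ T M => z.h ^ p := by
    intro p
    induction p with
    | zero => simpa using BddFam.const 1
    | succ p ih => simpa only [pow_succ] using ih.mul hh
  have hC : ∀ r l, BddFam fun z : StepConfig P μ ρ l₁ l₂ T M =>
      ∑ p ∈ Finset.range 6, pointStencil P μ ρ z.t z.x z.y r l p * z.h ^ p := fun r l =>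
    .sum fun p _ => (bddFam_theStencil ρ ha hb hd₁ hd₂ r l p).mul (hpow p)
  choose B hB using hC
  -- `B r l` bounds the stencil weight, `64 * M` comes from Taylor's formula, and `K` is the
  -- constant for exact Taylor jets.
  refine ⟨∑ r ∈ offs, ∑ l ∈ offs, B r l * (64 * M) + K, fun z => ?_⟩
  have hz := z.h_pos
  have h1 := hK z
  set c := pointStencil P μ ρ z.t z.x z.y with hc
  set W : ℕ → ℕ → ℝ := fun p q => z.h ^ (p + q) * jet z.u z.x z.y p q with hW
  have h2 : |discreteOp c z.h z.u z.x z.y - (z.h ^ 2)⁻¹ * evalMoment c z.h W| ≤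
      (∑ r ∈ offs, ∑ l ∈ offs, B r l * (64 * M)) * z.h ^ 4 := by
    rw [discreteOp, evalMoment, one_div, ← mul_sub, abs_mul, abs_of_pos (by positivity),
      inv_mul_le_iff₀ (by positivity)]
    simp only [← Finset.sum_sub_distrib, ← mul_sub, Finset.sum_mul, Finset.mul_sum]
    refine (Finset.abs_sum_le_sum_abs _ _).trans (Finset.sum_le_sum fun r hr =>
      (Finset.abs_sum_le_sum_abs _ _).trans (Finset.sum_le_sum fun l hl => ?_))
    have h3 := abs_sub_realTaylor_le z.smooth z.x_mem z.y_mem hz.le z.bound hr hl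
      (z.x_mem_closed r hr) (z.y_mem_closed l hl)
    rw [← Finset.sum_mul, abs_mul]
    calc _ ≤ B r l * (64 * M * z.h ^ 6) :=
          mul_le_mul (hB r l z) h3 (abs_nonneg _) ((abs_nonneg _).trans (hB r l z))
      _ = _ := by ring
  have h4 : discreteOp c z.h z.u z.x z.y - P.schemeRhs μ ρ z.w z.t z.x z.y c z.h =
      (discreteOp c z.h z.u z.x z.y - (z.h ^ 2)⁻¹ * evalMoment c z.h W) +
        ((z.h ^ 2)⁻¹ * evalMoment c z.h W - P.schemeRhs μ ρ z.w z.t z.x z.y c z.h) := by ring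
  rw [h4, add_mul]
  exact (abs_add_le _ _).trans (add_le_add h2 h1)

/-! ### Grid points and the theorem -/

lemma grid_mem_Ioo {N i : ℕ} {h : ℝ} (hl : l₁ < l₂) (hN : 0 < N) (hh : h = (l₂ - l₁) / N)
    (h0 : 0 < i) (hi : i < N) : l₁ + i * h ∈ Ioo l₁ l₂ := by
  have hN' : (0 : ℝ) < N := by exact_mod_cast hN
  have hpos : 0 < h := by rw [hh]; exact div_pos (sub_pos.2 hl) hN'
  have e : N * h = l₂ - l₁ := by rw [hh]; field_simp
  have h1 : (0 : ℝ) < i := by exact_mod_cast h0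
  have h2 : (i : ℝ) < N := by exact_mod_cast hi
  constructor <;> nlinarith

/-- Neighbours of interior grid points can lie on the boundary, since only `1 ≤ i` and `i + 1 ≤ N`
are available. -/
lemma grid_mem_Icc {N i : ℕ} {h : ℝ} (hl : l₁ < l₂) (hN : 0 < N) (hh : h = (l₂ - l₁) / N)
    (h0 : 0 < i) (hi : i < N) {r : ℤ} (hr : r ∈ offs) : l₁ + i * h + r * h ∈ Icc l₁ l₂ := by
  have hN' : (0 : ℝ) < N := by exact_mod_cast hN
  have hpos : 0 < h := by rw [hh]; exact div_pos (sub_pos.2 hl) hN'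
  have e : N * h = l₂ - l₁ := by rw [hh]; field_simp
  have h1 : (1 : ℝ) ≤ i := by exact_mod_cast h0
  have h2 : (i : ℝ) + 1 ≤ N := by exact_mod_cast hi
  rw [mem_offs] at hr
  rcases hr with rfl | rfl | rfl <;> push_cast <;> constructor <;> nlinarith

lemma Method.shift_pos (μ : Method) : 0 < μ.shift := by
  cases μ <;> norm_num [Method.shift]

end Final

end CompactFDM

end

theorem mainTheorem3 (l₁ l₂ T : ℝ) (hl : l₁ < l₂) (hT : 0 < T)
    (P : CompactFDM.ParabolicData) (hP : P.Admissible l₁ l₂ T)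
    (μ : CompactFDM.Method) (ρ : ℝ) (hρ : 0 < ρ) :
    ∃ c : ℝ → ℝ → ℝ → CompactFDM.Stencil,
      (∀ t ∈ Set.Icc 0 T, ∀ x ∈ Set.Ioo l₁ l₂, ∀ y ∈ Set.Ioo l₁ l₂,
        P.SchemeAt μ ρ t x y (c t x y) ∧
          ∀ c' : CompactFDM.Stencil, P.SchemeAt μ ρ t x y c' → c' = c t x y) ∧
      ∀ M : ℝ, ∃ K : ℝ, ∀ N : ℕ, 0 < N → ∀ h : ℝ, h = (l₂ - l₁) / N →
        ∀ n : ℕ, ∀ t : ℝ, t = (n + μ.shift) * (ρ * h) → t ≤ T →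
        ∀ (w : ℕ → ℝ → ℝ → ℝ) (u : ℝ → ℝ → ℝ), CompactFDM.SmoothXY l₁ l₂ u →
        (∀ x ∈ Set.Ioo l₁ l₂, ∀ y ∈ Set.Ioo l₁ l₂, P.StepEq μ (ρ * h) w u t x y) →
        (∀ p q : ℕ, p + q ≤ 6 → ∀ x ∈ Set.Ioo l₁ l₂, ∀ y ∈ Set.Ioo l₁ l₂,
          |CompactFDM.pd p q u x y| ≤ M) →
        ∀ i j : ℕ, 0 < i → i < N → 0 < j → j < N →
        ∀ x y : ℝ, x = l₁ + i * h → y = l₁ + j * h →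
          |CompactFDM.discreteOp (c t x y) h u x y
              - P.schemeRhs μ ρ w t x y (c t x y) h| ≤ K * h ^ 4 := by
  refine ⟨CompactFDM.pointStencil P μ ρ, fun t _ x _ y _ =>
    ⟨CompactFDM.isScheme_iff.2 rfl, fun c' hc' => CompactFDM.isScheme_iff.1 hc'⟩, fun M => ?_⟩
  obtain ⟨K, hK⟩ := CompactFDM.scheme_consistency (P := P) (μ := μ) (M := M) hP hl hT hρ.ne'
  refine ⟨K, fun N hN h hh n t ht htT w u hu hstep hM i j hi hiN hj hjN x y hx hy => ?_⟩
  subst hx hy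
  have hN1 : (1 : ℝ) ≤ N := by exact_mod_cast hN
  have hpos : 0 < h := by rw [hh]; exact div_pos (sub_pos.2 hl) (by linarith)
  have hle : h ≤ l₂ - l₁ := by rw [hh]; exact div_le_self (sub_pos.2 hl).le hN1
  -- The bounds on the data hold only for times in `[0, T]`.
  have ht0 : 0 ≤ t := by
    have := μ.shift_pos
    rw [ht]
    positivity
  exact hK
    { h := h
      t := t
      x := l₁ + i * h
      y := l₁ + j * h
      w := w
      u := u
      h_pos := hpos
      h_le := hle
      t_mem := ⟨ht0, htT⟩
      x_mem := CompactFDM.grid_mem_Ioo hl hN hh hi hiN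
      y_mem := CompactFDM.grid_mem_Ioo hl hN hh hj hjN
      x_mem_closed := fun r hr => CompactFDM.grid_mem_Icc hl hN hh hi hiN hr
      y_mem_closed := fun r hr => CompactFDM.grid_mem_Icc hl hN hh hj hjN hr
      smooth := hu
      step := hstep
      bound := hM }
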